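/- **Setting.** Fix a ground set $V$. A (randomized) $n$-way online correlated selection algorithm (OCS) receives at each timestep a subset of $V$ of size $n$ and irrevocably chooses one of its elements. A subsequence of input sets containing $u\in V$ is *consecutive* if every input set containing $u$ that arrives between its first and last members also belongs to it. A *two-way $\gamma$-OCS* is a two-way OCS such that, for every input, every $u$ and all disjoint consecutive subsequences of pairs containing $u$, of lengths $k_1,\dots,k_m$, the probability that $u$ is never chosen from any of them is at most $\prod_{i=1}^m (1/2)^{k_i}(1-\gamma)^{\max(k_i-1,0)}$. Let $\gamma_A = \frac1{16}$ and $\gamma_B=\frac{13\sqrt{13}-35}{108}$. Let $\mathcal A$ be the following two-way OCS. For an element $x$ and pairs $i<j$, let $(i,j)_x$ be an *ex-ante edge* if $j$ is the pair containing $x$ that immediately follows pair $i$, where $i$ also contains $x$. Each pair draws three independent fair bits. The first makes it a sender or a receiver, the second selects one of its two elements, and the third selects one of its two elements. An ex-ante edge $(i,j)_x$ is an *ex-post edge* if $i$ is a sender, $j$ is a receiver, and the second bits of both select $x$. If $(i,j)_x$ is an ex-post edge, $i$ outputs the element selected by its third bit, and $j$ outputs $x$ if and only if $i$ does not. Every unmatched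 pair outputs the element selected by its third bit. Let $\mathcal B$ be a two-way $\gamma_B$-OCS whose random choices are independent of those of $\mathcal A$. The *three-way OCS* acts as follows on each triple: a uniformly random pair of the triple (chosen independently of everything else) is given to $\mathcal A$, and then the pair consisting of the output of $\mathcal A$ and the element left out is given to $\mathcal B$, whose choice is the output. **Theorem.** A two-way $\gamma_B$-OCS $\mathcal B$ exists. For every such $\mathcal B$, every input sequence of triples, every $u\in V$, and every consecutive subsequence of $k\ge 0$ triples containing $u$, the probability that the three-way OCS chooses $u$ at none of these $k$ timesteps is at most $\eta(k)$, where $\eta(0)=1$ and, for $k\ge 1$, $$\eta(k) = c_1t_1^k+c_2t_2^k-c_3t_3^k-c_4t_4^k ,$$ $$c_1=\tfrac{8}{(3-\gamma_B)^2},\quad c_2=\tfrac{(1+\gamma_B)^2}{(1-\gamma_A)(1-\gamma_B)(3-\gamma_B)^2},\quad c_3=\gamma_A c_2,\quad c_4=\tfrac{\gamma_B}{(1-\gamma_A)(1-\gamma_B)},$$ $$t_1=\tfrac{2-\gamma_B}{3},\quad t_2=\tfrac{4-3\gamma_A-2\gamma_B+\gamma_A\gamma_B}{6},\quad t_3=\tfrac{1-\gamma_B}{6},\quad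 t_4=\tfrac{1-\gamma_A}{3}.$$ Up to an error less than $10^{-6}$, $c_1\approx 0.957795$, $c_2\approx 0.176756$, $c_3\approx 0.011047$, $c_4\approx 0.131738$, $t_1\approx 0.630024$, $t_2\approx 0.599919$, $t_3\approx 0.148345$, and $t_4=0.3125$ exactly. Moreover, for all $k\ge 0$, $$\eta(k)\le \left(\tfrac23\right)^k(1-\delta_1)^{\max(k-1,0)}(1-\delta_2)^{\max(k-2,0)},\qquad \delta_1=0.0309587,\ \delta_2=0.0165525.$$ -/

import Mathlib

open MeasureTheory

/-- The subsets of size `n` of a ground set `V`. -/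
abbrev KSet (n : ℕ) (V : Type*) := {s : Finset V // s.card = n}

/-- The elements of a set of size `n`, listed in some fixed order. The order is only used to let a
uniform index in `Fin n` select a uniform element of the set. -/
noncomputable def KSet.elt {n : ℕ} {V : Type*} (s : KSet n V) (i : Fin n) : V :=
  ((s.1.equivFinOfCardEq s.2).symm i : V)

theorem KSet.elt_mem {n : ℕ} {V : Type*} (s : KSet n V) (i : Fin n) : s.elt i ∈ s.1 :=
  ((s.1.equivFinOfCardEq s.2).symm i).2

/-- An `n`-way online correlated selection (OCS) algorithm on the ground set `V`: a randomized
online algorithm that at each timestep takes a subset of size `n` and irrevocably chooses one of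
its elements. Its randomness is a seed drawn from a probability space. The output at time `t`
depends only on the seed and on the inputs up to time `t`; hence nothing is lost by feeding the
algorithm an infinite input sequence, every finite input being a prefix of one. -/
structure OCS (n : ℕ) (V : Type*) where
  /-- the random seeds -/
  Seed : Type
  [seedSpace : MeasurableSpace Seed]
  /-- the distribution of the seed -/
  law : Measure Seed
  [law_prob : IsProbabilityMeasure law]
  /-- the element chosen at a timestep, given the seed and the input sequence -/
  output : Seed → (ℕ → KSet n V) → ℕ → V
  output_mem : ∀ r σ t, output r σ t ∈ (σ t).1
  online : ∀ r σ σ' t, (∀ i ≤ t, σ i = σ' i) → output r σ t = output r σ' t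
  measurable_output : ∀ σ t v, MeasurableSet {r | output r σ t = v}

attribute [instance] OCS.seedSpace OCS.law_prob

/-- `S` is (the set of timesteps of) a consecutive subsequence of sets containing `u`: all its sets
contain `u`, and every set containing `u` that arrives between two of its timesteps belongs to
it. Its length is `S.card`. -/
def IsConsecutive {n : ℕ} {V : Type*} (σ : ℕ → KSet n V) (u : V) (S : Finset ℕ) : Prop :=
  (∀ t ∈ S, u ∈ (σ t).1) ∧
    ∀ a ∈ S, ∀ b ∈ S, ∀ t, a < t → t < b → u ∈ (σ t).1 → t ∈ S

/-- A two-way `γ`-OCS: for every input, every element `u` and every family of `m` disjoint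
consecutive subsequences of pairs containing `u`, of lengths `k₁, …, kₘ`, the probability that `u`
is never chosen from any of them is at most `∏ (1/2) ^ kᵢ * (1 - γ) ^ max (kᵢ - 1) 0`
(the subtraction in the exponent is the truncated one). -/
def OCS.IsGamma {V : Type*} (B : OCS 2 V) (γ : ℝ) : Prop :=
  ∀ (σ : ℕ → KSet 2 V) (u : V) (m : ℕ) (S : Fin m → Finset ℕ),
    (∀ i, IsConsecutive σ u (S i)) → (∀ i j, i ≠ j → Disjoint (S i) (S j)) →
    B.law.real {r | ∀ i, ∀ t ∈ S i, B.output r σ t ≠ u} ≤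
      ∏ i, (1 / 2 : ℝ) ^ (S i).card * (1 - γ) ^ ((S i).card - 1)

/-- The law of an infinite sequence of independent uniform elements of a finite type. -/
noncomputable def iidUniform (α : Type) [Fintype α] [Nonempty α] [MeasurableSpace α] :
    Measure (ℕ → α) :=
  Measure.infinitePi fun _ => (PMF.uniformOfFintype α).toMeasure

instance (α : Type) [Fintype α] [Nonempty α] [MeasurableSpace α] :
    IsProbabilityMeasure (iidUniform α) := by
  unfold iidUniform; infer_instance

/-! ### The ex-post-graph two-way OCS -/

/-- The three random bits of a pair. -/
abbrev Bits := Fin 2 × Fin 2 × Fin 2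

/-- The first bit makes the pair a sender (`0`) or a receiver (`1`). -/
abbrev Bits.role (b : Bits) : Fin 2 := b.1

/-- The second bit selects the element of the pair along which it wants to be matched. -/
abbrev Bits.want (b : Bits) : Fin 2 := b.2.1

/-- The third bit selects the element of the pair that it chooses by default. -/
abbrev Bits.pick (b : Bits) : Fin 2 := b.2.2

/-- The edge `(i, j)_x` of the ex-ante graph: pair `j` is the pair containing `x` that immediately
follows pair `i`, which contains `x` as well. -/
def ExAnte {V : Type*} (σ : ℕ → KSet 2 V) (i j : ℕ) (x : V) : Prop :=
  i < j ∧ x ∈ (σ i).1 ∧ x ∈ (σ j).1 ∧ ∀ t, i < t → t < j → x ∉ (σ t).1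

/-- The edge `(i, j)_x` of the ex-post graph: `(i, j)_x` is in the ex-ante graph, `i` is a sender
that wants the edge along `x`, and `j` is a receiver that wants the edge along `x`. -/
def ExPost {V : Type*} (r : ℕ → Bits) (σ : ℕ → KSet 2 V) (i j : ℕ) (x : V) : Prop :=
  ExAnte σ i j x ∧ (r i).role = 0 ∧ (σ i).elt (r i).want = x ∧
    (r j).role = 1 ∧ (σ j).elt (r j).want = x

open Classical in
/-- The output for pair `j`. A pair that is not the receiver of an ex-post edge (an unmatched pair,
or a sender) chooses by its third bit. The receiver of an ex-post edge `(i, j)_x` makes the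
opposite decision about `x`: it chooses its other element if `i` chose `x`, and `x` if not. -/
noncomputable def exPostOutput {V : Type*} (r : ℕ → Bits) (σ : ℕ → KSet 2 V) (j : ℕ) : V :=
  if ∃ i x, ExPost r σ i j x ∧ (σ i).elt (r i).pick = x then (σ j).elt (1 - (r j).want)
  else if ∃ i x, ExPost r σ i j x ∧ (σ i).elt (r i).pick ≠ x then (σ j).elt (r j).want
  else (σ j).elt (r j).pick

theorem exPost_congr {V : Type*} {r r' : ℕ → Bits} {σ σ' : ℕ → KSet 2 V} {j : ℕ}
    (hr : ∀ i ≤ j, r i = r' i) (hσ : ∀ i ≤ j, σ i = σ' i) (i : ℕ) (x : V)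
    (h : ExPost r σ i j x) : ExPost r' σ' i j x := by
  obtain ⟨⟨hij, h1, h2, h3⟩, h4, h5, h6, h7⟩ := h
  rw [hr i hij.le] at h4 h5
  rw [hr j le_rfl] at h6 h7
  rw [hσ i hij.le] at h1 h5
  rw [hσ j le_rfl] at h2 h7
  refine ⟨⟨hij, h1, h2, fun t ht ht' => ?_⟩, h4, h5, h6, h7⟩
  rw [← hσ t ht'.le]
  exact h3 t ht ht'

theorem exPostOutput_congr {V : Type*} {r r' : ℕ → Bits} {σ σ' : ℕ → KSet 2 V} {j : ℕ}
    (hr : ∀ i ≤ j, r i = r' i) (hσ : ∀ i ≤ j, σ i = σ' i) :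
    exPostOutput r σ j = exPostOutput r' σ' j := by
  have h1 : ∀ i x, ExPost r σ i j x ↔ ExPost r' σ' i j x := fun i x =>
    ⟨exPost_congr hr hσ i x,
      exPost_congr (fun i hi => (hr i hi).symm) (fun i hi => (hσ i hi).symm) i x⟩
  have h2 : ∀ i x, (ExPost r σ i j x ∧ (σ i).elt (r i).pick = x) ↔
      (ExPost r' σ' i j x ∧ (σ' i).elt (r' i).pick = x) := by
    intro i x
    rw [h1]
    refine and_congr_right fun h => ?_
    rw [hr i h.1.1.le, hσ i h.1.1.le]
  have h3 : ∀ i x, (ExPost r σ i j x ∧ (σ i).elt (r i).pick ≠ x) ↔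
      (ExPost r' σ' i j x ∧ (σ' i).elt (r' i).pick ≠ x) := by
    intro i x
    rw [h1]
    refine and_congr_right fun h => ?_
    rw [hr i h.1.1.le, hσ i h.1.1.le]
  unfold exPostOutput
  rw [hr j le_rfl, hσ j le_rfl]
  classical
  exact if_congr (exists_congr fun i => exists_congr (h2 i)) rfl
    (if_congr (exists_congr fun i => exists_congr (h3 i)) rfl rfl)

/-- A set of sequences that depends only on finitely many coordinates is measurable. -/
theorem measurableSet_of_prefix {α : Type} [Finite α] [MeasurableSpace α]
    [DiscreteMeasurableSpace α] (t : ℕ) (E : Set (ℕ → α))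
    (hE : ∀ r r', (∀ i ≤ t, r i = r' i) → r ∈ E → r' ∈ E) : MeasurableSet E := by
  have : E = (Finset.Iic t).restrict ⁻¹' ((Finset.Iic t).restrict '' E) := by
    ext r
    refine ⟨fun h => ⟨r, h, rfl⟩, ?_⟩
    rintro ⟨r', h', h⟩
    refine hE r' r (fun i hi => ?_) h'
    exact congrFun h ⟨i, Finset.mem_Iic.2 hi⟩
  rw [this]
  exact (Finset.measurable_restrict (X := fun _ => α) _) (Set.toFinite _).measurableSet

/-- The two-way OCS that negatively correlates the two endpoints of each ex-post edge, with three
independent fair random bits for each pair. -/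
noncomputable def exPostOCS (V : Type*) : OCS 2 V where
  Seed := ℕ → Bits
  law := iidUniform Bits
  output := exPostOutput
  output_mem r σ t := by
    unfold exPostOutput
    split_ifs <;> exact KSet.elt_mem _ _
  online r σ σ' t h := exPostOutput_congr (fun _ _ => rfl) h
  measurable_output σ t v := by
    refine measurableSet_of_prefix t _ fun r r' h hr => ?_
    rw [Set.mem_ofPred_eq, ← exPostOutput_congr h (fun _ _ => rfl)]
    exact hr

/-! ### The three-way OCS -/

/-- The input of the first two-way OCS: at time `t`, the pair obtained from the triple `σ t` by
leaving out the element of index `c t`. -/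
noncomputable def firstInput {V : Type*} [DecidableEq V] (σ : ℕ → KSet 3 V) (c : ℕ → Fin 3) :
    ℕ → KSet 2 V := fun t =>
  ⟨(σ t).1.erase ((σ t).elt (c t)), by
    rw [Finset.card_erase_of_mem (KSet.elt_mem _ _), (σ t).2]⟩

/-- The input of the second two-way OCS: at time `t`, the pair consisting of the output of the
first OCS and of the element that was left out. -/
noncomputable def secondInput {V : Type*} [DecidableEq V] (A : OCS 2 V) (σ : ℕ → KSet 3 V)
    (c : ℕ → Fin 3) (a : A.Seed) : ℕ → KSet 2 V := fun t =>
  ⟨{A.output a (firstInput σ c) t, (σ t).elt (c t)},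
    Finset.card_pair (Finset.ne_of_mem_erase (A.output_mem a (firstInput σ c) t))⟩

theorem firstInput_congr {V : Type*} [DecidableEq V] {σ σ' : ℕ → KSet 3 V} {c c' : ℕ → Fin 3}
    {t : ℕ} (hσ : σ t = σ' t) (hc : c t = c' t) : firstInput σ c t = firstInput σ' c' t := by
  simp only [firstInput, hσ, hc]

theorem secondInput_congr {V : Type*} [DecidableEq V] (A : OCS 2 V) {σ σ' : ℕ → KSet 3 V}
    (c : ℕ → Fin 3) (a : A.Seed) {t : ℕ} (hσ : ∀ i ≤ t, σ i = σ' i) :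
    secondInput A σ c a t = secondInput A σ' c a t := by
  have h := A.online a (firstInput σ c) (firstInput σ' c) t
    (fun i hi => firstInput_congr (hσ i hi) rfl)
  simp only [secondInput, h, hσ t le_rfl]

theorem secondInput_subset {V : Type*} [DecidableEq V] (A : OCS 2 V) (σ : ℕ → KSet 3 V)
    (c : ℕ → Fin 3) (a : A.Seed) (t : ℕ) : (secondInput A σ c a t).1 ⊆ (σ t).1 := by
  intro x hx
  simp only [secondInput, Finset.mem_insert, Finset.mem_singleton] at hx
  rcases hx with rfl | rfl
  · exact Finset.mem_of_mem_erase (A.output_mem a (firstInput σ c) t)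
  · exact KSet.elt_mem _ _

/-- Feeding an OCS with a measurable random input, independent of its seed, whose value at each
timestep ranges over a finite set, gives measurable events. -/
theorem OCS.measurable_comp {V : Type*} {n : ℕ} (B : OCS n V) {X : Type*} [MeasurableSpace X]
    (f : X → ℕ → KSet n V) (F : ℕ → Finset V) (hF : ∀ x i, (f x i).1 ⊆ F i)
    (hf : ∀ i p, MeasurableSet {x | f x i = p}) (t : ℕ) (v : V) :
    MeasurableSet {z : X × B.Seed | B.output z.2 (f z.1) t = v} := by
  classical
  let hist : X → (Fin (t + 1) → Finset V) := fun x i => (f x i).1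
  have hfin : (Set.range hist).Finite := by
    refine (Set.Finite.pi' (fun i : Fin (t + 1) => ((F i).powerset).finite_toSet)).subset ?_
    rintro _ ⟨x, rfl⟩ i
    exact Finset.mem_coe.2 (Finset.mem_powerset.2 (hF x i))
  have hcongr : ∀ x y, hist x = hist y → ∀ b, B.output b (f x) t = B.output b (f y) t := by
    intro x y h b
    refine B.online b _ _ t fun i hi => Subtype.ext ?_
    exact congrFun h ⟨i, Nat.lt_succ_of_le hi⟩
  have hmeas : ∀ x, MeasurableSet {y | hist y = hist x} := by
    intro x
    have : {y | hist y = hist x} = ⋂ i : Fin (t + 1), {y | f y i = f x i} := by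
      ext y
      simp [hist, funext_iff, Subtype.ext_iff]
    rw [this]
    exact MeasurableSet.iInter fun i => hf _ _
  have key : {z : X × B.Seed | B.output z.2 (f z.1) t = v} =
      ⋃ h ∈ Set.range hist, {z : X × B.Seed | hist z.1 = h ∧
        ∃ x, hist x = h ∧ B.output z.2 (f x) t = v} := by
    ext z
    simp only [Set.mem_ofPred_eq, Set.mem_iUnion]
    constructor
    · intro h
      exact ⟨hist z.1, ⟨z.1, rfl⟩, rfl, z.1, rfl, h⟩
    · rintro ⟨h, -, h1, x, h2, h3⟩
      rw [hcongr z.1 x (h1.trans h2.symm), h3]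
  rw [key]
  refine MeasurableSet.biUnion hfin.countable ?_
  rintro _ ⟨x, rfl⟩
  have : {z : X × B.Seed | hist z.1 = hist x ∧
      ∃ y, hist y = hist x ∧ B.output z.2 (f y) t = v} =
      {y | hist y = hist x} ×ˢ {b | B.output b (f x) t = v} := by
    ext z
    simp only [Set.mem_ofPred_eq, Set.mem_prod]
    refine and_congr_right fun _ => ⟨?_, fun h => ⟨x, rfl, h⟩⟩
    rintro ⟨y, h1, h2⟩
    rw [← hcongr y x h1, h2]
  rw [this]
  exact (hmeas x).prod (B.measurable_output _ _ _)

theorem measurable_firstInput {V : Type*} [DecidableEq V] (σ : ℕ → KSet 3 V) (t : ℕ)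
    (p : KSet 2 V) : MeasurableSet {c : ℕ → Fin 3 | firstInput σ c t = p} := by
  refine measurableSet_of_prefix t _ fun c c' h hc => ?_
  rw [Set.mem_ofPred_eq, ← firstInput_congr rfl (h t le_rfl)]
  exact hc

theorem measurable_secondInput {V : Type*} [DecidableEq V] (A : OCS 2 V) (σ : ℕ → KSet 3 V)
    (t : ℕ) (p : KSet 2 V) :
    MeasurableSet {z : (ℕ → Fin 3) × A.Seed | secondInput A σ z.1 z.2 t = p} := by
  have h1 : ∀ v, MeasurableSet
      {z : (ℕ → Fin 3) × A.Seed | A.output z.2 (firstInput σ z.1) t = v} :=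
    A.measurable_comp (firstInput σ) (fun i => (σ i).1)
      (fun _ _ => Finset.erase_subset _ _) (measurable_firstInput σ) t
  have h2 : ∀ k, MeasurableSet {z : (ℕ → Fin 3) × A.Seed | z.1 t = k} := fun k =>
    measurableSet_eq_fun ((measurable_pi_apply t).comp measurable_fst) measurable_const
  have : {z : (ℕ → Fin 3) × A.Seed | secondInput A σ z.1 z.2 t = p} =
      ⋃ k : Fin 3, ⋃ v ∈ (σ t).1, ({z | z.1 t = k} ∩
        {z | A.output z.2 (firstInput σ z.1) t = v}) ∩
        {_z | ({v, (σ t).elt k} : Finset V) = p.1} := by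
    ext z
    simp only [secondInput, Subtype.ext_iff, Set.mem_ofPred_eq, Set.mem_iUnion, Set.mem_inter_iff]
    constructor
    · intro h
      exact ⟨_, _, Finset.mem_of_mem_erase (A.output_mem z.2 (firstInput σ z.1) t),
        ⟨rfl, rfl⟩, h⟩
    · rintro ⟨k, v, -, ⟨rfl, rfl⟩, h⟩
      exact h
  rw [this]
  refine MeasurableSet.iUnion fun k => Finset.measurableSet_biUnion _ fun v _ => ?_
  exact ((h2 k).inter (h1 v)).inter (MeasurableSet.const _)

/-- The three-way OCS built from two two-way OCS algorithms `A` and `B`. On the arrival of a triple,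
one of its three pairs is chosen uniformly at random (equivalently, a uniform element is left out);
`A` chooses an element of this pair; `B` then chooses between the output of `A` and the element
left out. The random pair choices, the randomness of `A` and the randomness of `B` are
independent. -/
noncomputable def composeOCS {V : Type*} [DecidableEq V] (A B : OCS 2 V) : OCS 3 V where
  Seed := ((ℕ → Fin 3) × A.Seed) × B.Seed
  law := ((iidUniform (Fin 3)).prod A.law).prod B.law
  output r σ t := B.output r.2 (secondInput A σ r.1.1 r.1.2) t
  output_mem r σ t := secondInput_subset A σ r.1.1 r.1.2 t
    (B.output_mem r.2 (secondInput A σ r.1.1 r.1.2) t)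
  online _ _ _ t h := B.online _ _ _ t fun _ hi =>
    secondInput_congr A _ _ fun j hj => h j (hj.trans hi)
  measurable_output σ t v :=
    B.measurable_comp (fun z : (ℕ → Fin 3) × A.Seed => secondInput A σ z.1 z.2)
      (fun i => (σ i).1) (fun z i => secondInput_subset A σ z.1 z.2 i)
      (measurable_secondInput A σ) t v

/-- The three-way OCS whose first two-way OCS is the ex-post-graph OCS and whose second two-way OCS
is `B`. -/
noncomputable def threeWayOCS {V : Type*} [DecidableEq V] (B : OCS 2 V) : OCS 3 V :=
  composeOCS (exPostOCS V) B

/-! ### The bound -/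

/-- The parameter of the first OCS. -/
noncomputable def gammaA : ℝ := 1 / 16

/-- The parameter of the second OCS. -/
noncomputable def gammaB : ℝ := (13 * √13 - 35) / 108

noncomputable def c₁ : ℝ := 8 / (3 - gammaB) ^ 2

noncomputable def c₂ : ℝ :=
  (1 + gammaB) ^ 2 / ((1 - gammaA) * (1 - gammaB) * (3 - gammaB) ^ 2)

noncomputable def c₃ : ℝ :=
  gammaA * (1 + gammaB) ^ 2 / ((1 - gammaA) * (1 - gammaB) * (3 - gammaB) ^ 2)

noncomputable def c₄ : ℝ := gammaB / ((1 - gammaA) * (1 - gammaB))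

noncomputable def t₁ : ℝ := (2 - gammaB) / 3

noncomputable def t₂ : ℝ := (4 - 3 * gammaA - 2 * gammaB + gammaA * gammaB) / 6

noncomputable def t₃ : ℝ := (1 - gammaB) / 6

noncomputable def t₄ : ℝ := (1 - gammaA) / 3

/-- The bound for a consecutive subsequence of length `k`; it is `1` for the empty subsequence. -/
noncomputable def eta (k : ℕ) : ℝ :=
  if k = 0 then 1 else c₁ * t₁ ^ k + c₂ * t₂ ^ k - c₃ * t₃ ^ k - c₄ * t₄ ^ k

noncomputable def δ₁ : ℝ := 0.0309587

noncomputable def δ₂ : ℝ := 0.0165525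

/-! Write g for `gammaB` and β = (1 - g)/2. If m of the pairs given to the second OCS contain `u`,
its guarantee (1/2)^m (1 - g)^max(m - 1, 0) equals (β^m - g 0^m)/(1 - g), a combination of two
weights that are products over timesteps (`second_real_le`). Here m is the number l of triples in
which `u` is left out, plus the number of the other n triples in which the first OCS chooses `u`.

Given the roles and the wanted elements, the ex-post graph is a fixed matching and the third bits
are still fair. A pair with no partner among the n pairs contributes an independent factor (1 + β)/2
to the expected weight. Two matched pairs contain exactly one choice of `u`, so they contribute β ≤
((1 + β)/2)^2. Hence the absence of a match (`missNone`) is the worse case, and a match gives at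
most `missMatched`. No match occurs with probability at most (15/16)^(n - 1): each pair but the
first is matched to its predecessor along `u` with probability at least 1/16, even given earlier
failures (`integral_exPostOCS_le`). The outcome is a combination of four products x^l y^n
(`missMatched_add_eq_missBound`), and averaging over the left-out elements turns each into ((x +
2y)/3)^k, which yields `eta` (`integral_missBound`).

A `gammaB`-OCS arises from the same matching argument with a biased role bit and receivers that may
accept an offer of either element. A single match inside the union of the subsequences already
forces `u` to be chosen, so only the probability of no match has to be bounded
(`iidLaw_forall_notMem_acceptEvent_le`).

All conditional estimates are made by resampling one coordinate of an i.i.d. sequence. The closed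
bound is checked directly for k ≤ 3 and extended by comparing successive ratios. -/

section IID

/-! ### Independent sequences and the resampling of coordinates. -/

variable {α : Type} [MeasurableSpace α]

theorem DependsOn.measurable_Iic [Finite α] [DiscreteMeasurableSpace α] {β : Type*}
    [MeasurableSpace β] {T : ℕ} {F : (ℕ → α) → β} (hF : DependsOn F (Set.Iic T)) :
    Measurable F := fun A _ =>
  measurableSet_of_prefix T _ fun r r' h hr => by
    rw [Set.mem_preimage, ← hF fun i hi => h i hi]
    exact hr

theorem DependsOn.finite_range_Iic {α : Type} [Finite α] {β : Type*} {T : ℕ} {F : (ℕ → α) → β}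
    (hF : DependsOn F (Set.Iic T)) : (Set.range F).Finite := by
  classical
  cases isEmpty_or_nonempty α with
  | inl h =>
    have : IsEmpty (ℕ → α) := ⟨fun f => h.false (f 0)⟩
    rw [Set.range_eq_empty]
    exact Set.finite_empty
  | inr h =>
    let a : α := Classical.choice h
    refine (Set.finite_range fun x : Finset.Iic T → α =>
      F fun i => if hi : i ∈ Finset.Iic T then x ⟨i, hi⟩ else a).subset ?_
    rintro _ ⟨r, rfl⟩
    refine ⟨fun i => r i, hF fun i hi => ?_⟩
    have : i ∈ Finset.Iic T := Finset.mem_Iic.2 hi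
    simp only [dif_pos this]

theorem DependsOn.integrable_Iic [Finite α] [DiscreteMeasurableSpace α] {T : ℕ}
    {F : (ℕ → α) → ℝ} (hF : DependsOn F (Set.Iic T)) (μ : Measure (ℕ → α))
    [IsFiniteMeasure μ] : Integrable F μ := by
  obtain ⟨C, hC⟩ := (hF.finite_range_Iic.image fun x => ‖x‖).bddAbove
  exact Integrable.of_bound hF.measurable_Iic.aestronglyMeasurable C
    (Filter.Eventually.of_forall fun ω => hC ⟨_, ⟨ω, rfl⟩, rfl⟩)

/-- The law of an infinite sequence of independent elements with law `ν`. -/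
noncomputable abbrev iidLaw (ν : Measure α) : Measure (ℕ → α) := Measure.infinitePi fun _ => ν

variable (ν : Measure α) [IsProbabilityMeasure ν]

theorem measurable_update_prod (i : ℕ) :
    Measurable fun z : (ℕ → α) × α => Function.update z.1 i z.2 := by
  refine measurable_pi_iff.2 fun j => ?_
  by_cases h : j = i
  · subst h
    simpa using measurable_snd
  · simp only [Function.update_of_ne h]
    fun_prop

/-- This invariance takes the place of conditioning on a coordinate: the old sequence is independent
of the fresh value. -/
theorem iidLaw_map_update (i : ℕ) :
    ((iidLaw ν).prod ν).map (fun z => Function.update z.1 i z.2) = iidLaw ν := by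
  refine Measure.eq_infinitePi _ fun s t ht => ?_
  rw [Measure.map_apply (measurable_update_prod i) (.pi s.countable_toSet fun _ _ => ht _)]
  have : (fun z : (ℕ → α) × α => Function.update z.1 i z.2) ⁻¹' Set.pi s t =
      Set.pi (s.erase i) t ×ˢ (if i ∈ s then t i else Set.univ) := by
    ext z
    simp only [Set.mem_preimage, Set.mem_pi, Set.mem_prod, Finset.coe_erase, Set.mem_sdiff,
      Finset.mem_coe, Set.mem_singleton_iff]
    constructor
    · refine fun h => ⟨fun j hj => by simpa [hj.2] using h j hj.1, ?_⟩
      split_ifs with hi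
      · simpa using h i hi
      · trivial
    · rintro ⟨h1, h2⟩ j hj
      by_cases hji : j = i
      · subst hji
        simpa [hj] using h2
      · simpa [hji] using h1 j ⟨hj, hji⟩
  rw [this, Measure.prod_prod, Measure.infinitePi_pi _ fun _ _ => ht _]
  split_ifs with hi
  · exact Finset.prod_erase_mul s _ hi
  · rw [measure_univ, mul_one, Finset.erase_eq_of_notMem hi]

theorem integral_iidLaw_update (i : ℕ) {F : (ℕ → α) → ℝ} (hF : Measurable F)
    (hI : Integrable F (iidLaw ν)) :
    ∫ ω, F ω ∂iidLaw ν = ∫ ω, ∫ x, F (Function.update ω i x) ∂ν ∂iidLaw ν := by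
  conv_lhs => rw [← iidLaw_map_update ν i]
  rw [integral_map (measurable_update_prod i).aemeasurable hF.aestronglyMeasurable]
  refine integral_prod _ ?_
  rw [← iidLaw_map_update ν i] at hI
  exact hI.comp_measurable (measurable_update_prod i)

/-- Resampling one coordinate, lower bound. -/
theorem mul_le_iidLaw_inter (i : ℕ) {N N' : Set (ℕ → α)} {X : Set α} (hN' : MeasurableSet N')
    (hX : MeasurableSet X) (h : ∀ ω ∈ N, ∀ x ∈ X, Function.update ω i x ∈ N') :
    ν.real X * (iidLaw ν).real N ≤ (iidLaw ν).real (N' ∩ {ω | ω i ∈ X}) := by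
  have hm : MeasurableSet (N' ∩ {ω | ω i ∈ X}) := hN'.inter (measurable_pi_apply i hX)
  conv_rhs => rw [← iidLaw_map_update ν i]
  rw [map_measureReal_apply (measurable_update_prod i) hm, mul_comm, ← measureReal_prod_prod]
  refine measureReal_mono ?_
  rintro ⟨ω, x⟩ ⟨h1, h2⟩
  exact ⟨h ω h1 x h2, by simpa using h2⟩

/-- Resampling one coordinate, upper bound. -/
theorem iidLaw_inter_le_mul (i : ℕ) {M : Set (ℕ → α)} {X : Set α} (hM : MeasurableSet M)
    (hX : MeasurableSet X) (h : ∀ ω, ∀ x ∈ X, Function.update ω i x ∈ M → ω ∈ M) :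
    (iidLaw ν).real (M ∩ {ω | ω i ∈ X}) ≤ ν.real X * (iidLaw ν).real M := by
  have hm : MeasurableSet (M ∩ {ω | ω i ∈ X}) := hM.inter (measurable_pi_apply i hX)
  conv_lhs => rw [← iidLaw_map_update ν i]
  rw [map_measureReal_apply (measurable_update_prod i) hm, mul_comm, ← measureReal_prod_prod]
  refine measureReal_mono ?_
  rintro ⟨ω, x⟩ ⟨h1, h2⟩
  have h3 : x ∈ X := by simpa using h2
  exact ⟨h ω x h3 h1, h3⟩

theorem integral_iidLaw_prod [Finite α] [DiscreteMeasurableSpace α] {ι : Type*} [DecidableEq ι]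
    (R : Finset ι) (s : ι → ℕ) (hs : Set.InjOn s R) (G : ι → α → ℝ) :
    ∫ ω, ∏ t ∈ R, G t (ω (s t)) ∂iidLaw ν = ∏ t ∈ R, ∫ x, G t x ∂ν := by
  induction R using Finset.induction_on with
  | empty => simp
  | insert a R ha ih =>
    have hdep : DependsOn (fun ω : ℕ → α => ∏ t ∈ insert a R, G t (ω (s t)))
        (Set.Iic ((insert a R).sup s)) := fun ω ω' h =>
      Finset.prod_congr rfl fun t ht => by
        rw [h (s t) (Finset.le_sup (f := s) ht)]
    rw [integral_iidLaw_update ν (s a) hdep.measurable_Iic (hdep.integrable_Iic _)]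
    have : ∀ ω : ℕ → α, ∀ x, ∏ t ∈ insert a R, G t (Function.update ω (s a) x (s t)) =
        G a x * ∏ t ∈ R, G t (ω (s t)) := by
      intro ω x
      rw [Finset.prod_insert ha, Function.update_self]
      congr 1
      refine Finset.prod_congr rfl fun t ht => ?_
      rw [Function.update_of_ne]
      intro h
      have := hs (by simp [ht]) (by simp) h
      exact ha (this ▸ ht)
    simp_rw [this, integral_mul_const, integral_const_mul]
    rw [Finset.prod_insert ha, ih (hs.mono (by simp))]

/-- Applying a function coordinatewise to two independent i.i.d. sequences gives an i.i.d.
sequence. -/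
theorem iidLaw_prod_map {β γ : Type} [MeasurableSpace β] [MeasurableSpace γ] (ν' : Measure β)
    [IsProbabilityMeasure ν'] {f : α × β → γ} (hf : Measurable f) :
    ((iidLaw ν).prod (iidLaw ν')).map (fun z t => f (z.1 t, z.2 t)) =
      Measure.infinitePi fun _ => (ν.prod ν').map f := by
  have hm : Measurable fun z : (ℕ → α) × (ℕ → β) => fun t => f (z.1 t, z.2 t) := by
    fun_prop
  have : IsProbabilityMeasure ((ν.prod ν').map f) :=
    Measure.isProbabilityMeasure_map hf.aemeasurable
  refine Measure.eq_infinitePi _ fun s t ht => ?_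
  have hms : MeasurableSet ((s : Set ℕ).pi t) := .pi s.countable_toSet fun _ _ => ht _
  rw [Measure.map_apply hm hms, Measure.prod_apply (hm hms)]
  have : ∀ ω : ℕ → α, iidLaw ν' (Prod.mk ω ⁻¹' ((fun z : (ℕ → α) × (ℕ → β) =>
      fun t => f (z.1 t, z.2 t)) ⁻¹' (s : Set ℕ).pi t)) =
      ∏ i ∈ s, ν' (Prod.mk (ω i) ⁻¹' (f ⁻¹' t i)) := by
    intro ω
    rw [← Measure.infinitePi_pi (fun _ => ν')
      fun i _ => (measurable_prodMk_left (x := ω i)) (hf (ht i))]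
    rfl
  simp_rw [this]
  have hind := ProbabilityTheory.iIndepFun_infinitePi (P := fun _ : ℕ => ν)
    (X := fun (i : ℕ) (x : α) => ν' (Prod.mk x ⁻¹' (f ⁻¹' t i)))
    (fun i => measurable_measure_prodMk_left (hf (ht i)))
  have hme : ∀ i, Measurable fun ω : ℕ → α => ν' (Prod.mk (ω i) ⁻¹' (f ⁻¹' t i)) := fun i =>
    (measurable_measure_prodMk_left (hf (ht i))).comp (measurable_pi_apply i)
  rw [ProbabilityTheory.lintegral_prod_eq_prod_lintegral_of_indepFun s _ hind hme]
  refine Finset.prod_congr rfl fun i _ => ?_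
  have h := lintegral_map (μ := iidLaw ν) (measurable_measure_prodMk_left (ν := ν') (hf (ht i)))
    (measurable_pi_apply i)
  rw [Measure.infinitePi_map_eval] at h
  rw [Measure.map_apply hf (ht i), Measure.prod_apply (hf (ht i)), h]

end IID

/-! ### Pairs -/

theorem KSet.elt_injective {n : ℕ} {V : Type*} (s : KSet n V) : Function.Injective s.elt :=
  fun _ _ h => (s.1.equivFinOfCardEq s.2).symm.injective (Subtype.ext h)

theorem KSet.exists_elt_eq {n : ℕ} {V : Type*} (s : KSet n V) {x : V} (hx : x ∈ s.1) :
    ∃ i, s.elt i = x :=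
  ⟨s.1.equivFinOfCardEq s.2 ⟨x, hx⟩, by simp [KSet.elt]⟩

theorem KSet.eq_or_eq {V : Type*} (s : KSet 2 V) {x y z : V} (hx : x ∈ s.1) (hy : y ∈ s.1)
    (hxy : x ≠ y) (hz : z ∈ s.1) : z = x ∨ z = y := by
  obtain ⟨i, rfl⟩ := s.exists_elt_eq hx
  obtain ⟨j, rfl⟩ := s.exists_elt_eq hy
  obtain ⟨k, rfl⟩ := s.exists_elt_eq hz
  have : i ≠ j := fun h => hxy (h ▸ rfl)
  have : k = i ∨ k = j := by omega
  exact this.imp (congrArg s.elt) (congrArg s.elt)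

theorem KSet.exists_ne {V : Type*} (s : KSet 2 V) (x : V) : ∃ y ∈ s.1, y ≠ x := by
  by_cases h : s.elt 0 = x
  · exact ⟨s.elt 1, s.elt_mem 1, fun h' => absurd (s.elt_injective (h.trans h'.symm)) (by decide)⟩
  · exact ⟨s.elt 0, s.elt_mem 0, h⟩

/-! ### Matchings of pairs -/

section Matching

variable {V : Type*}

/-- `M i j x` says that the pairs `i` and `j` are matched along their common element `x`, with `i`
the sender and `j` the receiver. -/
structure IsPairMatching (σ : ℕ → KSet 2 V) (M : ℕ → ℕ → V → Prop) : Prop where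
  mem_left : ∀ {i j x}, M i j x → x ∈ (σ i).1
  mem_right : ∀ {i j x}, M i j x → x ∈ (σ j).1
  sender_unique : ∀ {i j j' x x'}, M i j x → M i j' x' → j = j'
  receiver_unique : ∀ {i i' j x x'}, M i j x → M i' j x' → i = i' ∧ x = x'
  not_sender_of_receiver : ∀ {i j k x y}, M i j x → ¬ M j k y

/-- Along a matching, a receiver makes the opposite decision about the common element. Every other
pair chooses by its own bit. -/
structure IsMatchedOutput (σ : ℕ → KSet 2 V) (M : ℕ → ℕ → V → Prop) (p : ℕ → Fin 2)
    (o : ℕ → V) : Prop where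
  mem : ∀ j, o j ∈ (σ j).1
  unmatched : ∀ j, (∀ i x, ¬ M i j x) → o j = (σ j).elt (p j)
  matched : ∀ {i j x}, M i j x → (o j = x ↔ (σ i).elt (p i) ≠ x)

variable {σ : ℕ → KSet 2 V} {M : ℕ → ℕ → V → Prop} {u : V} {R : Finset ℕ}

theorem IsPairMatching.ne (hM : IsPairMatching σ M) {i j : ℕ} {x : V} (h : M i j x) : i ≠ j :=
  fun hij => hM.not_sender_of_receiver h (hij ▸ h : M j j x)

/-- Exactly one of two matched pairs containing `u` chooses `u`. -/
theorem IsMatchedOutput.eq_iff_ne (hM : IsPairMatching σ M) {p : ℕ → Fin 2} {o : ℕ → V}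
    (ho : IsMatchedOutput σ M p o) {i j : ℕ} {x : V} (h : M i j x) (hi : u ∈ (σ i).1)
    (hj : u ∈ (σ j).1) : o j = u ↔ o i ≠ u := by
  have h1 : o i = (σ i).elt (p i) := ho.unmatched i fun k y h' =>
    hM.not_sender_of_receiver h' h
  have h2 := ho.matched h
  rw [← h1] at h2
  by_cases hx : x = u
  · subst hx
    exact h2
  · have h3 := (σ i).eq_or_eq (hM.mem_left h) hi hx (ho.mem i)
    have h4 := (σ j).eq_or_eq (hM.mem_right h) hj hx (ho.mem j)
    constructor
    · intro h5 h6
      have : o j = x := h2.2 (h6 ▸ fun h => hx h.symm)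
      exact hx (this.symm.trans h5)
    · intro h5
      rcases h4 with h4 | h4
      · exact absurd (h3.resolve_right h5) (h2.1 h4)
      · exact h4

/-- Whether a pair containing `u` chooses `u` is decided by a single bit: that of its sender if it
is a receiver, and its own bit otherwise. -/
theorem IsPairMatching.exists_source (hM : IsPairMatching σ M) (hR : ∀ t ∈ R, u ∈ (σ t).1) :
    ∃ (s : ℕ → ℕ) (b : ℕ → Fin 2), (∀ t, s t = t ∨ ∃ x, M (s t) t x) ∧
      ∀ p o, IsMatchedOutput σ M p o → ∀ t ∈ R, (o t = u ↔ p (s t) = b t) := by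
  have key : ∀ t, ∃ (s : ℕ) (b : Fin 2), (s = t ∨ ∃ x, M s t x) ∧
      ∀ p o, IsMatchedOutput σ M p o → t ∈ R → (o t = u ↔ p s = b) := by
    intro t
    by_cases ht : t ∈ R
    · by_cases h : ∃ i x, M i t x
      · obtain ⟨i, x, h⟩ := h
        obtain ⟨a, ha⟩ := (σ i).exists_elt_eq (hM.mem_left h)
        have hpa : ∀ p : ℕ → Fin 2, (σ i).elt (p i) = x ↔ p i = a := fun p =>
          ⟨fun h => (σ i).elt_injective (h.trans ha.symm), fun h => h ▸ ha⟩
        by_cases hx : x = u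
        · refine ⟨i, 1 - a, Or.inr ⟨x, h⟩, fun p o ho _ => ?_⟩
          rw [← hx, ho.matched h, ne_eq, hpa]
          generalize p i = c
          clear * -
          revert a c
          decide
        -- Here `u` is the element other than `x` in both pairs, so the receiver takes `u` exactly
        -- when the sender takes `x`.
        · refine ⟨i, a, Or.inr ⟨x, h⟩, fun p o ho _ => ?_⟩
          rw [← hpa, ← not_iff_not, ← ne_eq ((σ i).elt (p i)), ← ho.matched h]
          have h4 := (σ t).eq_or_eq (hM.mem_right h) (hR t ht) hx (ho.mem t)
          exact ⟨fun h5 => h4.resolve_right h5, fun h5 h6 => hx (h5.symm.trans h6)⟩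
      · obtain ⟨a, ha⟩ := (σ t).exists_elt_eq (hR t ht)
        refine ⟨t, a, Or.inl rfl, fun p o ho _ => ?_⟩
        rw [ho.unmatched t fun i x h' => h ⟨i, x, h'⟩]
        exact ⟨fun h => (σ t).elt_injective (h.trans ha.symm), fun h => h ▸ ha⟩
    · exact ⟨t, 0, Or.inl rfl, fun _ _ _ h => absurd h ht⟩
  choose s b h1 h2 using key
  exact ⟨s, b, h1, fun p o ho t ht => h2 t p o ho ht⟩

/-- The law of a bit that is `0` with probability `p`. -/
noncomputable def bitLaw (p : ℝ) : Measure (Fin 2) :=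
  ENNReal.ofReal p • Measure.dirac 0 + ENNReal.ofReal (1 - p) • Measure.dirac 1

/-- The law of a fair bit. -/
noncomputable abbrev fairBit : Measure (Fin 2) := bitLaw (1 / 2)

theorem isProbabilityMeasure_bitLaw {p : ℝ} (h0 : 0 ≤ p) (h1 : p ≤ 1) :
    IsProbabilityMeasure (bitLaw p) := by
  constructor
  simp only [bitLaw, Measure.coe_add, Measure.coe_smul, Pi.add_apply, Pi.smul_apply, measure_univ,
    smul_eq_mul, mul_one]
  rw [← ENNReal.ofReal_add h0 (by linarith)]
  simp

instance : IsProbabilityMeasure fairBit :=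
  isProbabilityMeasure_bitLaw (by norm_num) (by norm_num)

theorem bitLaw_real_zero {p : ℝ} (h0 : 0 ≤ p) : (bitLaw p).real {0} = p := by
  simp [bitLaw, Measure.real, h0]

theorem bitLaw_real_one {p : ℝ} (h1 : p ≤ 1) : (bitLaw p).real {1} = 1 - p := by
  simp [bitLaw, Measure.real, h1]

theorem fairBit_real_singleton (b : Fin 2) : fairBit.real {b} = 1 / 2 := by
  fin_cases b
  · exact bitLaw_real_zero (by norm_num)
  · refine (bitLaw_real_one (by norm_num)).trans (by norm_num)

theorem integral_fairBit (f : Fin 2 → ℝ) : ∫ x, f x ∂fairBit = (f 0 + f 1) / 2 := by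
  rw [integral_fintype Integrable.of_finite, Fin.sum_univ_two, fairBit_real_singleton,
    fairBit_real_singleton, smul_eq_mul, smul_eq_mul]
  ring

open Classical in
/-- The weight `β ^ n`, where `n` is the number of the pairs in `R` that choose `u`. -/
noncomputable def choiceWeight (β : ℝ) (u : V) (R : Finset ℕ) (o : ℕ → V) : ℝ :=
  ∏ t ∈ R, if o t = u then β else 1

variable {out : (ℕ → Fin 2) → ℕ → V} {β : ℝ}

/-- If no two pairs in `R` are matched, then they choose independently. -/
theorem integral_choiceWeight_of_unmatched (hM : IsPairMatching σ M)
    (hout : ∀ p, IsMatchedOutput σ M p (out p)) (hR : ∀ t ∈ R, u ∈ (σ t).1)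
    (h : ¬ ∃ i ∈ R, ∃ j ∈ R, ∃ x, M i j x) (β : ℝ) :
    ∫ p, choiceWeight β u R (out p) ∂iidLaw fairBit = ((1 + β) / 2) ^ R.card := by
  classical
  obtain ⟨s, b, hs, hb⟩ := hM.exists_source hR
  -- Two pairs share a source only if one sends to the other, which is excluded inside `R`, or if
  -- both receive from the same sender, which makes them equal.
  have hinj : Set.InjOn s R := by
    intro t ht t' ht' htt
    rcases hs t with h1 | ⟨x, h1⟩ <;> rcases hs t' with h2 | ⟨y, h2⟩
    · rw [← h1, ← h2, htt]
    · rw [← htt, h1] at h2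
      exact absurd ⟨t, ht, t', ht', y, h2⟩ h
    · rw [htt, h2] at h1
      exact absurd ⟨t', ht', t, ht, x, h1⟩ h
    · rw [← htt] at h2
      exact hM.sender_unique h1 h2
  have : ∀ p, choiceWeight β u R (out p) = ∏ t ∈ R, if p (s t) = b t then β else 1 := fun p =>
    Finset.prod_congr rfl fun t ht => if_congr (hb p _ (hout p) t ht) rfl rfl
  simp_rw [this]
  rw [integral_iidLaw_prod fairBit R s hinj fun t x => if x = b t then β else 1,
    Finset.prod_congr rfl (g := fun _ => (1 + β) / 2), Finset.prod_const]
  intro t _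
  rw [integral_fairBit]
  generalize b t = c
  fin_cases c <;> simp [add_comm]

/-- Two matched pairs in `R` contribute exactly one choice of `u`. -/
theorem choiceWeight_of_matched (hM : IsPairMatching σ M) {p : ℕ → Fin 2} {o : ℕ → V}
    (ho : IsMatchedOutput σ M p o) (hR : ∀ t ∈ R, u ∈ (σ t).1) {i j : ℕ} {x : V} (hi : i ∈ R)
    (hj : j ∈ R) (h : M i j x) :
    choiceWeight β u R o = β * choiceWeight β u ((R.erase i).erase j) o := by
  classical
  have hj' : j ∈ R.erase i := Finset.mem_erase.2 ⟨(hM.ne h).symm, hj⟩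
  unfold choiceWeight
  rw [← Finset.mul_prod_erase R _ hi, ← Finset.mul_prod_erase _ _ hj', ← mul_assoc]
  congr 1
  have := ho.eq_iff_ne hM h (hR i hi) (hR j hj)
  by_cases h1 : o i = u <;> simp [this, h1]

/-- Remove matched pairs of `R` two at a time. Each removal costs β in place of ((1 + β)/2)^2, and
the difference of the two is ((1 - β)/2)^2 ≥ 0. -/
theorem integral_choiceWeight_le (hM : IsPairMatching σ M)
    (hout : ∀ p, IsMatchedOutput σ M p (out p)) (hβ0 : 0 ≤ β) (hR : ∀ t ∈ R, u ∈ (σ t).1) :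
    ∫ p, choiceWeight β u R (out p) ∂iidLaw fairBit ≤ ((1 + β) / 2) ^ R.card := by
  induction hn : R.card using Nat.strong_induction_on generalizing R with
  | _ n ih =>
    by_cases h : ∃ i ∈ R, ∃ j ∈ R, ∃ x, M i j x
    · obtain ⟨i, hi, j, hj, x, h⟩ := h
      have hj' : j ∈ R.erase i := Finset.mem_erase.2 ⟨(hM.ne h).symm, hj⟩
      have hc : ((R.erase i).erase j).card + 2 = n := by
        rw [← hn, ← Finset.card_erase_add_one hi, ← Finset.card_erase_add_one hj']
      simp_rw [fun p => choiceWeight_of_matched (β := β) hM (hout p) hR hi hj h]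
      rw [integral_const_mul]
      have := ih _ (by omega) (R := (R.erase i).erase j)
        (fun t ht => hR t (Finset.mem_of_mem_erase (Finset.mem_of_mem_erase ht))) rfl
      refine (mul_le_mul_of_nonneg_left this hβ0).trans ?_
      rw [← hc, pow_add, mul_comm]
      refine mul_le_mul_of_nonneg_left ?_ (by positivity)
      nlinarith [sq_nonneg (1 - β)]
    · rw [integral_choiceWeight_of_unmatched hM hout hR h, hn]

/-- One match is kept at its exact cost β; any others are bounded as if they were absent. For β = 0
the right side vanishes, so a match inside `R` forces a choice of `u`. -/
theorem integral_choiceWeight_le_of_matched (hM : IsPairMatching σ M)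
    (hout : ∀ p, IsMatchedOutput σ M p (out p)) (hβ0 : 0 ≤ β) (hR : ∀ t ∈ R, u ∈ (σ t).1)
    (h : ∃ i ∈ R, ∃ j ∈ R, ∃ x, M i j x) :
    ∫ p, choiceWeight β u R (out p) ∂iidLaw fairBit ≤
      β * ((1 + β) / 2) ^ (R.card - 2) := by
  obtain ⟨i, hi, j, hj, x, h⟩ := h
  have hj' : j ∈ R.erase i := Finset.mem_erase.2 ⟨(hM.ne h).symm, hj⟩
  simp_rw [fun p => choiceWeight_of_matched (β := β) hM (hout p) hR hi hj h]
  rw [integral_const_mul]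
  have := integral_choiceWeight_le hM hout hβ0 (R := (R.erase i).erase j)
    (fun t ht => hR t (Finset.mem_of_mem_erase (Finset.mem_of_mem_erase ht)))
  rw [Finset.card_erase_of_mem hj', Finset.card_erase_of_mem hi] at this
  exact mul_le_mul_of_nonneg_left this hβ0

end Matching

/-! ### Random bits with a biased role -/

/-- The law of the bits of a pair that is a sender with probability `p`. -/
noncomputable def bitsLaw (p : ℝ) : Measure Bits := (bitLaw p).prod (fairBit.prod fairBit)

theorem isProbabilityMeasure_bitsLaw {p : ℝ} (h0 : 0 ≤ p) (h1 : p ≤ 1) :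
    IsProbabilityMeasure (bitsLaw p) := by
  have := isProbabilityMeasure_bitLaw h0 h1
  unfold bitsLaw
  infer_instance

/-- The bits `b` with the last one replaced by `x`. -/
def Bits.repick (b : Bits) (x : Fin 2) : Bits := (b.1, b.2.1, x)

/-- The sequence of bits `r` with the last bits replaced by those of `p`. -/
def repick (r : ℕ → Bits) (p : ℕ → Fin 2) : ℕ → Bits := fun t => (r t).repick (p t)

theorem bitsLaw_map_repick {p : ℝ} (h0 : 0 ≤ p) (h1 : p ≤ 1) :
    ((bitsLaw p).prod fairBit).map (fun z => z.1.repick z.2) = bitsLaw p := by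
  have := isProbabilityMeasure_bitLaw h0 h1
  have := isProbabilityMeasure_bitsLaw h0 h1
  refine Measure.ext_of_singleton fun b => ?_
  rw [Measure.map_apply (by fun_prop) (measurableSet_singleton b)]
  have : (fun z : Bits × Fin 2 => z.1.repick z.2) ⁻¹' {b} =
      ({b.1} ×ˢ ({b.2.1} ×ˢ Set.univ)) ×ˢ {b.2.2} := by
    ext z
    simp [Bits.repick, Prod.ext_iff, and_assoc]
  rw [this, Measure.prod_prod]
  have hb : ({b} : Set Bits) = {b.1} ×ˢ ({b.2.1} ×ˢ {b.2.2}) := by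
    simp
  rw [hb]
  simp only [bitsLaw, Measure.prod_prod, measure_univ, mul_one, mul_assoc]

theorem iidLaw_bitsLaw_map_repick {p : ℝ} (h0 : 0 ≤ p) (h1 : p ≤ 1) :
    ((iidLaw (bitsLaw p)).prod (iidLaw fairBit)).map (fun z => repick z.1 z.2) =
      iidLaw (bitsLaw p) := by
  have := isProbabilityMeasure_bitsLaw h0 h1
  refine (iidLaw_prod_map (bitsLaw p) fairBit (f := fun z => z.1.repick z.2)
    (by fun_prop)).trans ?_
  simp_rw [bitsLaw_map_repick h0 h1]

/-- The inner integral is the expectation given roles and wanted elements. These determine the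
matching, so it is fixed while the choices are averaged. -/
theorem integral_iidLaw_bitsLaw_repick {p : ℝ} (h0 : 0 ≤ p) (h1 : p ≤ 1)
    {F : (ℕ → Bits) → ℝ} (hF : Measurable F) (hI : Integrable F (iidLaw (bitsLaw p))) :
    ∫ r, F r ∂iidLaw (bitsLaw p) =
      ∫ r, ∫ x, F (repick r x) ∂iidLaw fairBit ∂iidLaw (bitsLaw p) := by
  have := isProbabilityMeasure_bitsLaw h0 h1
  have hm : Measurable fun z : (ℕ → Bits) × (ℕ → Fin 2) => repick z.1 z.2 :=
    measurable_pi_iff.2 fun t => (Measurable.of_discrete (f := fun z : Bits × Fin 2 =>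
      z.1.repick z.2)).comp (f := fun z : (ℕ → Bits) × (ℕ → Fin 2) => (z.1 t, z.2 t))
      (by fun_prop)
  conv_lhs => rw [← iidLaw_bitsLaw_map_repick h0 h1]
  rw [integral_map hm.aemeasurable hF.aestronglyMeasurable]
  refine integral_prod _ ?_
  rw [← iidLaw_bitsLaw_map_repick h0 h1] at hI
  exact hI.comp_measurable hm

theorem toMeasure_uniformOfFintype_bits :
    (PMF.uniformOfFintype Bits).toMeasure = bitsLaw (1 / 2) := by
  have := isProbabilityMeasure_bitsLaw (p := 1 / 2) (by norm_num) (by norm_num)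
  refine Measure.ext_of_singleton fun b => ?_
  have hb : ({b} : Set Bits) = {b.1} ×ˢ ({b.2.1} ×ˢ {b.2.2}) := by
    simp
  rw [← measureReal_eq_measureReal_iff]
  have h1 : (bitsLaw (1 / 2)).real {b} = 1 / 8 := by
    rw [hb, bitsLaw, measureReal_prod_prod, measureReal_prod_prod]
    simp_rw [fairBit_real_singleton]
    norm_num
  rw [h1, Measure.real, PMF.toMeasure_apply_singleton _ _ (measurableSet_singleton b)]
  simp [Fintype.card_prod]

/-- The bits of a role that want a given element of the pair `s`. -/
def wantSet {V : Type*} (s : KSet 2 V) (role : Fin 2) (x : V) : Set Bits :=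
  {b | b.role = role ∧ s.elt b.want = x}

theorem bitsLaw_real_wantSet {V : Type*} {p : ℝ} {s : KSet 2 V} {x : V}
    (hx : x ∈ s.1) (role : Fin 2) :
    (bitsLaw p).real (wantSet s role x) = (bitLaw p).real {role} / 2 := by
  obtain ⟨a, rfl⟩ := s.exists_elt_eq hx
  have : wantSet s role (s.elt a) = {role} ×ˢ ({a} ×ˢ Set.univ) := by
    ext b
    simp [wantSet, s.elt_injective.eq_iff]
  rw [this, bitsLaw, measureReal_prod_prod, measureReal_prod_prod, fairBit_real_singleton]
  simp
  ring

/-! ### The ex-ante graph -/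

section ExAnte

variable {V : Type*} {σ : ℕ → KSet 2 V} {i i' j j' : ℕ} {x u : V}

theorem ExAnte.left_unique (h : ExAnte σ i j x) (h' : ExAnte σ i' j x) : i = i' := by
  rcases lt_trichotomy i i' with hi | hi | hi
  · exact absurd h'.2.1 (h.2.2.2 i' hi h'.1)
  · exact hi
  · exact absurd h.2.1 (h'.2.2.2 i hi h.1)

theorem ExAnte.right_unique (h : ExAnte σ i j x) (h' : ExAnte σ i j' x) : j = j' := by
  rcases lt_trichotomy j j' with hj | hj | hj
  · exact absurd h.2.2.1 (h'.2.2.2 j h.1 hj)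
  · exact hj
  · exact absurd h'.2.2.1 (h.2.2.2 j' h'.1 hj)

/-- A pair of a consecutive subsequence is preceded in it by another pair, unless it is the first
one. -/
theorem IsConsecutive.exists_targets {S : Finset ℕ} (hS : IsConsecutive σ u S) :
    ∃ J ⊆ S, J.card = S.card - 1 ∧ ∀ j ∈ J, ∃ i ∈ S, ExAnte σ i j u := by
  rcases S.eq_empty_or_nonempty with rfl | hne
  · exact ⟨∅, subset_rfl, rfl, by simp⟩
  -- Only the earliest pair has no predecessor in `S`; this is the source of every exponent reduced
  -- by one.
  · refine ⟨S.erase (S.min' hne), Finset.erase_subset _ _,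
      Finset.card_erase_of_mem (S.min'_mem hne), fun j hj => ?_⟩
    obtain ⟨hj1, hj2⟩ := Finset.mem_erase.1 hj
    have hne' : (S.filter (· < j)).Nonempty :=
      ⟨S.min' hne, Finset.mem_filter.2 ⟨S.min'_mem hne,
        lt_of_le_of_ne (S.min'_le j hj2) (Ne.symm hj1)⟩⟩
    obtain ⟨h1, h2⟩ := Finset.mem_filter.1 ((S.filter (· < j)).max'_mem hne')
    refine ⟨_, h1, h2, hS.1 _ h1, hS.1 _ hj2, fun t ht1 ht2 ht3 => ?_⟩
    have := hS.2 _ h1 _ hj2 t ht1 ht2 ht3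
    exact absurd ((S.filter (· < j)).le_max' t (Finset.mem_filter.2 ⟨this, ht2⟩))
      (not_le.2 ht1)

end ExAnte

/-! ### Avoiding a sequence of events -/

/-- If each event of a finite sequence has conditional probability at least `γ` given that none of
the previous ones happens, then the probability that none happens is at most `(1 - γ) ^ n`. -/
theorem measureReal_forall_notMem_le {Ω : Type*} [MeasurableSpace Ω] (μ : Measure Ω)
    [IsProbabilityMeasure μ] {E : ℕ → Set Ω} {γ : ℝ} (hγ : γ ≤ 1) (J : Finset ℕ)
    (hE : ∀ j ∈ J, MeasurableSet (E j))
    (h : ∀ J' ⊆ J, ∀ j ∈ J, (∀ i ∈ J', i < j) →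
      γ * μ.real {ω | ∀ i ∈ J', ω ∉ E i} ≤ μ.real ({ω | ∀ i ∈ J', ω ∉ E i} ∩ E j)) :
    μ.real {ω | ∀ i ∈ J, ω ∉ E i} ≤ (1 - γ) ^ J.card := by
  induction J using Finset.induction_on_max with
  | empty => simp
  | insert a J ha ih =>
    have hn : a ∉ J := fun h' => lt_irrefl _ (ha a h')
    have h1 := h J (Finset.subset_insert _ _) a (Finset.mem_insert_self _ _) ha
    have h2 := ih (fun j hj => hE j (Finset.mem_insert_of_mem hj)) fun J' hJ' j hj =>
      h J' (hJ'.trans (Finset.subset_insert _ _)) j (Finset.mem_insert_of_mem hj)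
    have h3 := measureReal_inter_add_sdiff (μ := μ) (s := {ω | ∀ i ∈ J, ω ∉ E i})
      (hE a (Finset.mem_insert_self _ _))
    have h4 : {ω | ∀ i ∈ insert a J, ω ∉ E i} = {ω | ∀ i ∈ J, ω ∉ E i} \ E a := by
      ext ω
      simp [and_comm]
    rw [h4, Finset.card_insert_of_notMem hn, pow_succ]
    -- Removing the last event leaves at most 1 - γ of the mass on which the earlier ones fail.
    nlinarith [mul_le_mul_of_nonneg_right h2 (sub_nonneg.2 hγ)]

section Events

variable {V : Type*} {σ : ℕ → KSet 2 V} {u : V} {R J : Finset ℕ} {prev : ℕ → ℕ}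

/-! ### The matching of the ex-post graph -/

theorem isPairMatching_exPost (r : ℕ → Bits) (σ : ℕ → KSet 2 V) :
    IsPairMatching σ (ExPost r σ) where
  mem_left h := h.1.2.1
  mem_right h := h.1.2.2.1
  sender_unique := by
    rintro i j j' x x' ⟨h1, -, h3, -⟩ ⟨h1', -, h3', -⟩
    obtain rfl : x = x' := h3.symm.trans h3'
    exact h1.right_unique h1'
  receiver_unique := by
    rintro i i' j x x' ⟨h1, -, -, -, h5⟩ ⟨h1', -, -, -, h5'⟩
    obtain rfl : x = x' := h5.symm.trans h5'
    exact ⟨h1.left_unique h1', rfl⟩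
  not_sender_of_receiver := by
    rintro i j k x y ⟨-, -, -, h4, -⟩ ⟨-, h2, -⟩
    exact absurd (h4.symm.trans h2) (by decide)

theorem isMatchedOutput_exPostOutput (r : ℕ → Bits) (σ : ℕ → KSet 2 V) :
    IsMatchedOutput σ (ExPost r σ) (fun t => (r t).pick) (exPostOutput r σ) where
  mem j := (exPostOCS V).output_mem r σ j
  unmatched j h := by
    unfold exPostOutput
    rw [if_neg, if_neg]
    · exact fun ⟨i, x, h', _⟩ => h i x h'
    · exact fun ⟨i, x, h', _⟩ => h i x h'
  matched := by
    intro i j x h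
    have hu : ∀ i' x', ExPost r σ i' j x' → i = i' ∧ x = x' := fun i' x' h' =>
      (isPairMatching_exPost r σ).receiver_unique h h'
    have hx : (σ j).elt (r j).want = x := h.2.2.2.2
    unfold exPostOutput
    by_cases hp : (σ i).elt (r i).pick = x
    · rw [if_pos ⟨i, x, h, hp⟩, ← hx, (σ j).elt_injective.eq_iff, hx]
      refine iff_of_false ?_ (not_not.2 hp)
      generalize (r j).want = c
      revert c
      decide
    · rw [if_neg, if_pos ⟨i, x, h, hp⟩]
      · exact iff_of_true hx hp
      · rintro ⟨i', x', h', hp'⟩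
        obtain ⟨rfl, rfl⟩ := hu i' x' h'
        exact hp hp'

/-! ### The two-way OCS with receivers that accept any offer -/

/-- The sender `i` offers its element `x` to the next pair `j` that contains it. -/
def Offer (r : ℕ → Bits) (σ : ℕ → KSet 2 V) (i j : ℕ) (x : V) : Prop :=
  ExAnte σ i j x ∧ r i ∈ wantSet (σ i) 0 x

/-- The receiver `j` accepts the offer of `x` by `i`: it accepts an offer of the element that it
wants if there is one, and otherwise an offer of its other element. -/
def Accept (r : ℕ → Bits) (σ : ℕ → KSet 2 V) (i j : ℕ) (x : V) : Prop :=
  Offer r σ i j x ∧ (r j).role = 1 ∧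
    ((σ j).elt (r j).want = x ∨ ∀ i', ¬ Offer r σ i' j ((σ j).elt (r j).want))

theorem Offer.left_unique {r : ℕ → Bits} {i i' j : ℕ} {x : V} (h : Offer r σ i j x)
    (h' : Offer r σ i' j x) : i = i' :=
  h.1.left_unique h'.1

/-- A receiver may get offers of both its elements. The wanted element breaks the tie, so at most
one offer is accepted. -/
theorem isPairMatching_accept (r : ℕ → Bits) (σ : ℕ → KSet 2 V) :
    IsPairMatching σ (Accept r σ) where
  mem_left h := h.1.1.2.1
  mem_right h := h.1.1.2.2.1
  sender_unique := by
    rintro i j j' x x' ⟨⟨h1, -, h2⟩, -⟩ ⟨⟨h1', -, h2'⟩, -⟩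
    obtain rfl : x = x' := h2.symm.trans h2'
    exact h1.right_unique h1'
  receiver_unique := by
    rintro i i' j x x' ⟨h1, -, h3⟩ ⟨h1', -, h3'⟩
    have key : x = x' := by
      by_cases hx : (σ j).elt (r j).want = x
      · rcases h3' with h3' | h3'
        · exact hx.symm.trans h3'
        · exact absurd (hx ▸ h1) (h3' i)
      · by_cases hx' : (σ j).elt (r j).want = x'
        · exact absurd (hx' ▸ h1') (h3.resolve_left hx i')
        · exact (((σ j).eq_or_eq (KSet.elt_mem _ _) h1.1.2.2.1 hx h1'.1.2.2.1).resolve_left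
            (Ne.symm hx')).symm
    subst key
    exact ⟨h1.left_unique h1', rfl⟩
  not_sender_of_receiver := by
    rintro i j k x y ⟨-, h2, -⟩ ⟨⟨-, h1, -⟩, -⟩
    exact absurd (h2.symm.trans h1) (by decide)

theorem offer_congr {r r' : ℕ → Bits} {σ σ' : ℕ → KSet 2 V} {j : ℕ}
    (hr : ∀ i ≤ j, r i = r' i) (hσ : ∀ i ≤ j, σ i = σ' i) (i : ℕ) (x : V) :
    Offer r σ i j x ↔ Offer r' σ' i j x := by
  by_cases hij : i < j
  · unfold Offer ExAnte
    rw [hr i hij.le, hσ i hij.le, hσ j le_rfl]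
    have : (∀ t, i < t → t < j → x ∉ (σ t).1) ↔ ∀ t, i < t → t < j → x ∉ (σ' t).1 :=
      forall_congr' fun t => forall_congr' fun _ => forall_congr' fun ht => by rw [hσ t ht.le]
    rw [this]
  · exact iff_of_false (fun h => hij h.1.1) (fun h => hij h.1.1)

theorem accept_congr {r r' : ℕ → Bits} {σ σ' : ℕ → KSet 2 V} {j : ℕ}
    (hr : ∀ i ≤ j, r i = r' i) (hσ : ∀ i ≤ j, σ i = σ' i) (i : ℕ) (x : V) :
    Accept r σ i j x ↔ Accept r' σ' i j x := by
  unfold Accept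
  simp only [offer_congr hr hσ, hr j le_rfl, hσ j le_rfl]

/-- The decisions about `v` by which the receiver `j` of a matched pair chooses the opposite of its
sender. -/
def IsOpposite (r : ℕ → Bits) (σ : ℕ → KSet 2 V) (j : ℕ) (v : V) : Prop :=
  v ∈ (σ j).1 ∧ ∃ i x, Accept r σ i j x ∧ (v = x ↔ (σ i).elt (r i).pick ≠ x)

open Classical in
/-- The output for pair `j`: the opposite of its sender if it accepts an offer, and its default
choice otherwise. -/
noncomputable def acceptOutput (r : ℕ → Bits) (σ : ℕ → KSet 2 V) (j : ℕ) : V :=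
  if h : ∃ v, IsOpposite r σ j v then h.choose else (σ j).elt (r j).pick

theorem isOpposite_congr {r r' : ℕ → Bits} {σ σ' : ℕ → KSet 2 V} {j : ℕ}
    (hr : ∀ i ≤ j, r i = r' i) (hσ : ∀ i ≤ j, σ i = σ' i) :
    IsOpposite r σ j = IsOpposite r' σ' j := by
  funext v
  unfold IsOpposite
  simp only [accept_congr hr hσ, hσ j le_rfl]
  refine propext (and_congr_right fun _ => exists_congr fun i => exists_congr fun x =>
    and_congr_right fun h => ?_)
  rw [hr i h.1.1.1.le, hσ i h.1.1.1.le]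

theorem acceptOutput_congr {r r' : ℕ → Bits} {σ σ' : ℕ → KSet 2 V} {j : ℕ}
    (hr : ∀ i ≤ j, r i = r' i) (hσ : ∀ i ≤ j, σ i = σ' i) :
    acceptOutput r σ j = acceptOutput r' σ' j := by
  have h := isOpposite_congr hr hσ
  unfold acceptOutput
  rw [hr j le_rfl, hσ j le_rfl]
  -- The chosen value depends only on the predicate, so equal predicates give equal choices.
  generalize IsOpposite r σ j = P at h ⊢
  subst h
  rfl

theorem isMatchedOutput_acceptOutput (r : ℕ → Bits) (σ : ℕ → KSet 2 V) :
    IsMatchedOutput σ (Accept r σ) (fun t => (r t).pick) (acceptOutput r σ) where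
  mem j := by
    unfold acceptOutput
    split_ifs with h
    · exact h.choose_spec.1
    · exact KSet.elt_mem _ _
  unmatched j h := by
    unfold acceptOutput
    rw [dif_neg]
    exact fun ⟨v, _, i, x, h', _⟩ => h i x h'
  matched := by
    intro i j x h
    have hex : ∃ v, IsOpposite r σ j v := by
      by_cases hp : (σ i).elt (r i).pick = x
      · obtain ⟨y, hy, hyx⟩ := (σ j).exists_ne x
        exact ⟨y, hy, i, x, h, iff_of_false hyx (not_not.2 hp)⟩
      · exact ⟨x, h.1.1.2.2.1, i, x, h, iff_of_true rfl hp⟩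
    unfold acceptOutput
    rw [dif_pos hex]
    obtain ⟨-, i', x', h', h2⟩ := hex.choose_spec
    obtain ⟨rfl, rfl⟩ := (isPairMatching_accept r σ).receiver_unique h h'
    exact h2

/-- The two-way OCS in which each pair is a sender with probability `p`, a sender offers a
uniformly random one of its elements to the next pair containing it, and a receiver of an offer
makes the opposite decision. -/
noncomputable def acceptOCS (V : Type*) {p : ℝ} (h0 : 0 ≤ p) (h1 : p ≤ 1) : OCS 2 V where
  Seed := ℕ → Bits
  law := iidLaw (bitsLaw p)
  law_prob := by
    have := isProbabilityMeasure_bitsLaw h0 h1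
    infer_instance
  output := acceptOutput
  output_mem r σ := (isMatchedOutput_acceptOutput r σ).mem
  online r σ σ' t h := acceptOutput_congr (fun _ _ => rfl) h
  measurable_output σ t v := by
    refine measurableSet_of_prefix t _ fun r r' h hr => ?_
    rw [Set.mem_ofPred_eq, ← acceptOutput_congr h (fun _ _ => rfl)]
    exact hr

/-! ### Events that force a match inside a set of pairs -/

/-- The pairs `prev j` and `j` are matched along `u` in the ex-post graph. -/
def exPostEvent (σ : ℕ → KSet 2 V) (u : V) (prev : ℕ → ℕ) (j : ℕ) : Set (ℕ → Bits) :=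
  {r | r (prev j) ∈ wantSet (σ (prev j)) 0 u ∧ r j ∈ wantSet (σ j) 1 u}

/-- The pair `prev j` offers `u` to the receiver `j`, which gets no offer of another wanted element
from outside of `R`. -/
def acceptEvent (σ : ℕ → KSet 2 V) (u : V) (R : Finset ℕ) (prev : ℕ → ℕ) (j : ℕ) :
    Set (ℕ → Bits) :=
  {r | r (prev j) ∈ wantSet (σ (prev j)) 0 u ∧ (r j).role = 1 ∧
    ((σ j).elt (r j).want = u ∨ ∀ i ∉ R, ¬ Offer r σ i j ((σ j).elt (r j).want))}

theorem exPost_of_mem_exPostEvent {j : ℕ} (hj : ExAnte σ (prev j) j u) {r : ℕ → Bits}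
    (h : r ∈ exPostEvent σ u prev j) : ExPost r σ (prev j) j u :=
  ⟨hj, h.1.1, h.1.2, h.2.1, h.2.2⟩

/-- If the offer of `u` loses to an offer of the other element, that rival offer comes from `R`, so
the match still lies inside `R`. This is why the event excludes only offers from outside. -/
theorem exists_accept_of_mem_acceptEvent {j : ℕ} (hj : ExAnte σ (prev j) j u)
    (hR : prev j ∈ R) {r : ℕ → Bits} (h : r ∈ acceptEvent σ u R prev j) :
    ∃ i ∈ R, ∃ x, Accept r σ i j x := by
  obtain ⟨h1, h2, h3⟩ := h
  by_cases h4 : (σ j).elt (r j).want = u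
  · exact ⟨prev j, hR, u, ⟨hj, h1⟩, h2, Or.inl h4⟩
  · by_cases h5 : ∃ i, Offer r σ i j ((σ j).elt (r j).want)
    · obtain ⟨i, h5⟩ := h5
      have hi : i ∈ R := by
        by_contra hi
        exact h3.resolve_left h4 i hi h5
      exact ⟨i, hi, _, h5, h2, Or.inl rfl⟩
    · exact ⟨prev j, hR, u, ⟨hj, h1⟩, h2, Or.inr fun i h6 => h5 ⟨i, h6⟩⟩

theorem measurableSet_exPostEvent {j : ℕ} (hj : prev j ≤ j) :
    MeasurableSet (exPostEvent σ u prev j) := by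
  refine measurableSet_of_prefix j _ fun r r' h hr => ?_
  unfold exPostEvent at hr ⊢
  rwa [Set.mem_ofPred_eq, ← h _ hj, ← h j le_rfl]

theorem measurableSet_acceptEvent {j : ℕ} (hj : prev j ≤ j) :
    MeasurableSet (acceptEvent σ u R prev j) := by
  refine measurableSet_of_prefix j _ fun r r' h hr => ?_
  unfold acceptEvent at hr ⊢
  rw [Set.mem_ofPred_eq] at hr ⊢
  simp only [← h _ hj, ← h j le_rfl, ← offer_congr h fun _ _ => rfl]
  exact hr

theorem measurableSet_forall_notMem {Ω : Type*} [MeasurableSpace Ω] {E : ℕ → Set Ω}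
    {J : Finset ℕ} (hE : ∀ j ∈ J, MeasurableSet (E j)) :
    MeasurableSet {ω | ∀ j ∈ J, ω ∉ E j} := by
  have : {ω | ∀ j ∈ J, ω ∉ E j} = ⋂ j ∈ J, (E j)ᶜ := by
    ext ω
    simp
  rw [this]
  exact Finset.measurableSet_biInter _ fun j hj => (hE j hj).compl

end Events

/-! ### The probability that no match is forced. -/

section Bounds

variable {V : Type*} {σ : ℕ → KSet 2 V} {u : V} {R J : Finset ℕ} {prev : ℕ → ℕ}

theorem mem_exPostEvent_update {i j : ℕ} (h1 : i ≠ prev j) (h2 : i ≠ j) (r : ℕ → Bits)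
    (b : Bits) :
    Function.update r i b ∈ exPostEvent σ u prev j ↔ r ∈ exPostEvent σ u prev j := by
  unfold exPostEvent
  rw [Set.mem_ofPred_eq, Set.mem_ofPred_eq, Function.update_of_ne h1.symm,
    Function.update_of_ne h2.symm]

theorem offer_update_of_ne {i k j : ℕ} {x : V} (h : i ≠ k) (r : ℕ → Bits) (b : Bits) :
    Offer (Function.update r i b) σ k j x ↔ Offer r σ k j x := by
  unfold Offer
  rw [Function.update_of_ne h.symm]

theorem mem_acceptEvent_update {i j : ℕ} (h1 : i ≠ prev j) (h2 : i ≠ j) (hi : i ∈ R)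
    (r : ℕ → Bits) (b : Bits) :
    Function.update r i b ∈ acceptEvent σ u R prev j ↔ r ∈ acceptEvent σ u R prev j := by
  unfold acceptEvent
  rw [Set.mem_ofPred_eq, Set.mem_ofPred_eq, Function.update_of_ne h1.symm,
    Function.update_of_ne h2.symm]
  refine and_congr_right fun _ => and_congr_right fun _ => or_congr_right ?_
  refine forall_congr' fun k => forall_congr' fun hk => not_congr (offer_update_of_ne ?_ r b)
  rintro rfl
  exact hk hi

theorem not_mem_wantSet_zero_of_role_one {s : KSet 2 V} {x : V} {b : Bits}
    (h : b ∈ wantSet s 0 x) (h' : b.role = 1) : False :=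
  absurd (h.1.symm.trans h') (by decide)

/-- Given that the earlier events fail, `prev j` may be reset to a sender of `u` and `j` to a
receiver wanting `u` without triggering any of them. The conditional probability is thus at least
p/2 · (1 - p)/2. -/
theorem iidLaw_forall_notMem_exPostEvent_le
    (hJ : ∀ j ∈ J, ExAnte σ (prev j) j u) {p : ℝ} (h0 : 0 ≤ p) (h1 : p ≤ 1) :
    (iidLaw (bitsLaw p)).real {r | ∀ j ∈ J, r ∉ exPostEvent σ u prev j} ≤
      (1 - p / 2 * ((1 - p) / 2)) ^ J.card := by
  have := isProbabilityMeasure_bitsLaw h0 h1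
  have hmeas : ∀ j ∈ J, MeasurableSet (exPostEvent σ u prev j) := fun j hj =>
    measurableSet_exPostEvent (hJ j hj).1.le
  refine measureReal_forall_notMem_le _ (by nlinarith) J hmeas fun J' hJ' j hj hlt => ?_
  set N : Set (ℕ → Bits) := {r | ∀ i ∈ J', r ∉ exPostEvent σ u prev i} with hN
  have hNm : MeasurableSet N := measurableSet_forall_notMem fun i hi => hmeas i (hJ' hi)
  have hpj := hJ j hj
  have hA := mul_le_iidLaw_inter (bitsLaw p) (prev j) (N := N) (N' := N)
    (X := wantSet (σ (prev j)) 0 u) hNm (Set.toFinite _).measurableSet <| by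
      intro r hr b hb i hi hmem
      -- A pair has only one successor along `u`.
      have hne : prev j ≠ prev i := fun h => by
        have := hJ i (hJ' hi)
        rw [← h] at this
        exact (hlt i hi).ne (this.right_unique hpj)
      by_cases hji : prev j = i
      -- If `prev j` is itself an earlier target, its event needs it to be a receiver, whereas the
      -- new bits make it a sender.
      · have := hmem.2.1
        rw [← hji, Function.update_self] at this
        exact not_mem_wantSet_zero_of_role_one hb this
      · exact hr i hi ((mem_exPostEvent_update hne hji r b).1 hmem)
  have hB := mul_le_iidLaw_inter (bitsLaw p) j
    (N := N ∩ {r | r (prev j) ∈ wantSet (σ (prev j)) 0 u})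
    (N' := N ∩ {r | r (prev j) ∈ wantSet (σ (prev j)) 0 u})
    (X := wantSet (σ j) 1 u)
    (hNm.inter (measurable_pi_apply _ (Set.toFinite _).measurableSet))
    (Set.toFinite _).measurableSet <| by
      rintro r ⟨hr, hr'⟩ b hb
      refine ⟨fun i hi hmem => ?_, ?_⟩
      · refine hr i hi ((mem_exPostEvent_update ?_ (hlt i hi).ne' r b).1 hmem)
        exact ((hJ i (hJ' hi)).1.trans (hlt i hi)).ne'
      · rw [Set.mem_ofPred_eq, Function.update_of_ne hpj.1.ne]
        exact hr'
  rw [bitsLaw_real_wantSet hpj.2.1, bitLaw_real_zero h0] at hA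
  rw [bitsLaw_real_wantSet hpj.2.2.1, bitLaw_real_one h1, Set.inter_assoc] at hB
  have hB' : (1 - p) / 2 * (iidLaw (bitsLaw p)).real
      (N ∩ {r | r (prev j) ∈ wantSet (σ (prev j)) 0 u}) ≤
      (iidLaw (bitsLaw p)).real (N ∩ exPostEvent σ u prev j) := hB
  nlinarith [mul_le_mul_of_nonneg_left hA (show 0 ≤ (1 - p) / 2 by linarith)]

/-- The offer of `u` costs p/2. Then `j` is a receiver wanting `u`, with probability (1 - p)/2, or a
receiver wanting its other element `x` without an outside offer of `x`, with probability at least (1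
- p)/2 · (1 - p/2). The product is p(1 - p)(4 - p)/8. -/
theorem iidLaw_forall_notMem_acceptEvent_le
    (hJR : J ⊆ R) (hJ : ∀ j ∈ J, ExAnte σ (prev j) j u) (hprev : ∀ j ∈ J, prev j ∈ R)
    {p : ℝ} (h0 : 0 ≤ p) (h1 : p ≤ 1) :
    (iidLaw (bitsLaw p)).real {r | ∀ j ∈ J, r ∉ acceptEvent σ u R prev j} ≤
      (1 - p * (1 - p) * (4 - p) / 8) ^ J.card := by
  have := isProbabilityMeasure_bitsLaw h0 h1
  set μ := iidLaw (bitsLaw p) with hμ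
  have hmeas : ∀ j ∈ J, MeasurableSet (acceptEvent σ u R prev j) := fun j hj =>
    measurableSet_acceptEvent (hJ j hj).1.le
  refine measureReal_forall_notMem_le _ ?_ J hmeas fun J' hJ' j hj hlt => ?_
  · have : p * (1 - p) ≤ 1 := by nlinarith
    nlinarith [mul_nonneg h0 (sub_nonneg.2 h1)]
  set N : Set (ℕ → Bits) := {r | ∀ i ∈ J', r ∉ acceptEvent σ u R prev i} with hN
  have hNm : MeasurableSet N := measurableSet_forall_notMem fun i hi => hmeas i (hJ' hi)
  have hpj := hJ j hj
  have hju := hpj.2.2.1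
  obtain ⟨x, hx, hxu⟩ := (σ j).exists_ne u
  set N₁ : Set (ℕ → Bits) := N ∩ {r | r (prev j) ∈ wantSet (σ (prev j)) 0 u} with hN₁
  have hN₁m : MeasurableSet N₁ :=
    hNm.inter (measurable_pi_apply _ (Set.toFinite _).measurableSet)
  have hA : p / 2 * μ.real N ≤ μ.real N₁ := by
    have := mul_le_iidLaw_inter (bitsLaw p) (prev j) (N := N) (N' := N)
      (X := wantSet (σ (prev j)) 0 u) hNm (Set.toFinite _).measurableSet <| by
        intro r hr b hb i hi hmem
        have hne : prev j ≠ prev i := fun h => by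
          have := hJ i (hJ' hi)
          rw [← h] at this
          exact (hlt i hi).ne (this.right_unique hpj)
        by_cases hji : prev j = i
        · have := hmem.2.1
          rw [← hji, Function.update_self] at this
          exact not_mem_wantSet_zero_of_role_one hb this
        · exact hr i hi ((mem_acceptEvent_update hne hji (hprev j hj) r b).1 hmem)
    rwa [bitsLaw_real_wantSet hpj.2.1, bitLaw_real_zero h0] at this
  have hB : ∀ y ∈ (σ j).1, (1 - p) / 2 * μ.real N₁ ≤
      μ.real (N₁ ∩ {r | r j ∈ wantSet (σ j) 1 y}) := by
    intro y hy
    have := mul_le_iidLaw_inter (bitsLaw p) j (N := N₁) (N' := N₁) (X := wantSet (σ j) 1 y)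
      hN₁m (Set.toFinite _).measurableSet <| by
        rintro r ⟨hr, hr'⟩ b hb
        refine ⟨fun i hi hmem => ?_, ?_⟩
        · refine hr i hi ((mem_acceptEvent_update ?_ (hlt i hi).ne' (hJR hj) r b).1 hmem)
          exact ((hJ i (hJ' hi)).1.trans (hlt i hi)).ne'
        · rw [Set.mem_ofPred_eq, Function.update_of_ne hpj.1.ne]
          exact hr'
    rwa [bitsLaw_real_wantSet hy, bitLaw_real_one h1] at this
  set N₂ : Set (ℕ → Bits) := N₁ ∩ {r | r j ∈ wantSet (σ j) 1 x} with hN₂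
  have hN₂m : MeasurableSet N₂ :=
    hN₁m.inter (measurable_pi_apply _ (Set.toFinite _).measurableSet)
  set Q : Set (ℕ → Bits) := {r | ∃ i ∉ R, Offer r σ i j x} with hQ
  have hQm : MeasurableSet Q := by
    refine measurableSet_of_prefix j _ fun r r' h hr => ?_
    obtain ⟨i, hi, hr⟩ := hr
    exact ⟨i, hi, (offer_congr h (fun _ _ => rfl) i x).1 hr⟩
  -- Only the predecessor `w` of `j` along `x` can make the outside offer. Making `w` offer to `j`
  -- withdraws any offer it made to an earlier target, so it can only help the earlier events occur:
  -- the outside offer and their failure are negatively correlated.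
  have hC : μ.real (N₂ ∩ Q) ≤ p / 2 * μ.real N₂ := by
    by_cases hw : ∃ w ∉ R, ExAnte σ w j x
    · obtain ⟨w, hwR, hw⟩ := hw
      have hQw : Q ⊆ {r | r w ∈ wantSet (σ w) 0 x} := by
        rintro r ⟨i, -, hi⟩
        obtain rfl := hi.1.left_unique hw
        exact hi.2
      have := iidLaw_inter_le_mul (bitsLaw p) w (M := N₂) (X := wantSet (σ w) 0 x) hN₂m
        (Set.toFinite _).measurableSet <| by
          rintro r b hb ⟨⟨hr1, hr2⟩, hr3⟩
          have hwv : prev j ≠ w := fun h => hwR (h ▸ hprev j hj)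
          have hwj : j ≠ w := fun h => hwR (h ▸ hJR hj)
          rw [Set.mem_ofPred_eq, Function.update_of_ne hwv] at hr2
          rw [Set.mem_ofPred_eq, Function.update_of_ne hwj] at hr3
          refine ⟨⟨fun i hi hmem => hr1 i hi ?_, hr2⟩, hr3⟩
          have hwi : i ≠ w := fun h => hwR (h ▸ hJR (hJ' hi))
          have hwi' : prev i ≠ w := fun h => hwR (h ▸ hprev i (hJ' hi))
          unfold acceptEvent at hmem ⊢
          rw [Set.mem_ofPred_eq] at hmem ⊢
          rw [Function.update_of_ne hwi, Function.update_of_ne hwi']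
          refine ⟨hmem.1, hmem.2.1, hmem.2.2.imp id fun hno k hk hoff => ?_⟩
          by_cases hkw : k = w
          · subst hkw
            obtain ⟨ho1, ho2⟩ := hoff
            rw [Function.update_self] at ho2
            rw [ho2.2.symm.trans hb.2] at ho1
            exact (hlt i hi).ne (ho1.right_unique hw)
          · exact hno k hk ((offer_update_of_ne (Ne.symm hkw) r b).1 hoff)
      rw [bitsLaw_real_wantSet hw.2.1, bitLaw_real_zero h0] at this
      exact (measureReal_mono (Set.inter_subset_inter_right _ hQw)).trans this
    · have : N₂ ∩ Q = ∅ := by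
        rw [Set.eq_empty_iff_forall_notMem]
        rintro r ⟨-, i, hi, h⟩
        exact hw ⟨i, hi, h.1⟩
      rw [this, measureReal_empty]
      positivity
  have hD := measureReal_inter_add_sdiff (μ := μ) (s := N₂) hQm
  have hsub : (N₁ ∩ {r | r j ∈ wantSet (σ j) 1 u}) ∪ (N₂ \ Q) ⊆
      N ∩ acceptEvent σ u R prev j := by
    rintro r (⟨⟨hr1, hr2⟩, hr3⟩ | ⟨⟨⟨hr1, hr2⟩, hr3⟩, hr4⟩)
    · exact ⟨hr1, hr2, hr3.1, Or.inl hr3.2⟩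
    · refine ⟨hr1, hr2, hr3.1, Or.inr fun i hi hoff => hr4 ⟨i, hi, ?_⟩⟩
      rwa [hr3.2] at hoff
  have hdisj : Disjoint (N₁ ∩ {r | r j ∈ wantSet (σ j) 1 u}) (N₂ \ Q) := by
    rw [Set.disjoint_left]
    rintro r ⟨-, hr⟩ ⟨⟨-, hr'⟩, -⟩
    exact hxu (hr'.2.symm.trans hr.2)
  have hE := measureReal_mono (μ := μ) hsub
  rw [measureReal_union hdisj (hN₂m.diff hQm)] at hE
  have hBu := hB u hju
  have hBx : (1 - p) / 2 * μ.real N₁ ≤ μ.real N₂ := hB x hx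
  -- The two disjoint cases add up to (1 - p)/2 · (1 + (1 - p/2)) times the measure of `N₁`.
  have e1 : (1 - p / 2) * ((1 - p) / 2 * μ.real N₁) ≤ (1 - p / 2) * μ.real N₂ :=
    mul_le_mul_of_nonneg_left hBx (by linarith)
  have e2 : (1 - p) / 2 * (2 - p / 2) * (p / 2 * μ.real N) ≤
      (1 - p) / 2 * (2 - p / 2) * μ.real N₁ :=
    mul_le_mul_of_nonneg_left hA (mul_nonneg (by linarith) (by linarith))
  nlinarith

end Bounds

/-! ### Existence of the second OCS. -/

section Gamma

variable {V : Type*} {σ : ℕ → KSet 2 V} {u : V} {R : Finset ℕ}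

theorem choiceWeight_zero (u : V) (R : Finset ℕ) (o : ℕ → V) :
    choiceWeight 0 u R o = Set.indicator {o | ∀ t ∈ R, o t ≠ u} 1 o := by
  classical
  by_cases h : ∀ t ∈ R, o t ≠ u
  · rw [Set.indicator_of_mem (s := {o : ℕ → V | ∀ t ∈ R, o t ≠ u}) h]
    exact Finset.prod_eq_one fun t ht => if_neg (h t ht)
  · rw [Set.indicator_of_notMem (s := {o : ℕ → V | ∀ t ∈ R, o t ≠ u}) h]
    push Not at h
    obtain ⟨t, ht, h⟩ := h
    exact Finset.prod_eq_zero ht (if_pos h)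

theorem choiceWeight_nonneg {β : ℝ} (hβ : 0 ≤ β) (u : V) (R : Finset ℕ) (o : ℕ → V) :
    0 ≤ choiceWeight β u R o := by
  classical
  exact Finset.prod_nonneg fun t _ => by split_ifs <;> linarith

theorem dependsOn_choiceWeight {α : Type} {out : (ℕ → α) → ℕ → V}
    (hout : ∀ r r' j, (∀ i ≤ j, r i = r' i) → out r j = out r' j) (β : ℝ) (u : V)
    (R : Finset ℕ) :
    DependsOn (fun r => choiceWeight β u R (out r)) (Set.Iic (R.sup id)) := by
  classical
  intro r r' h
  refine Finset.prod_congr rfl fun t ht => ?_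
  rw [hout r r' t fun i hi => h i (hi.trans (Finset.le_sup (f := id) ht))]

/-- `Accept` never reads the third bits, so the matchings of `r` and `repick r x` agree by
definition. -/
theorem isMatchedOutput_acceptOutput_repick (r : ℕ → Bits) (x : ℕ → Fin 2)
    (σ : ℕ → KSet 2 V) :
    IsMatchedOutput σ (Accept r σ) x (acceptOutput (repick r x) σ) :=
  isMatchedOutput_acceptOutput (repick r x) σ

theorem isMatchedOutput_exPostOutput_repick (r : ℕ → Bits) (x : ℕ → Fin 2)
    (σ : ℕ → KSet 2 V) :
    IsMatchedOutput σ (ExPost r σ) x (exPostOutput (repick r x) σ) :=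
  isMatchedOutput_exPostOutput (repick r x) σ

/-- The probability that no pair of `R` chooses `u`. -/
theorem acceptOCS_real_le {J : Finset ℕ} (hR : ∀ t ∈ R, u ∈ (σ t).1) (hJR : J ⊆ R)
    (hJ : ∀ j ∈ J, ∃ i ∈ R, ExAnte σ i j u) {p : ℝ} (h0 : 0 ≤ p) (h1 : p ≤ 1) :
    (iidLaw (bitsLaw p)).real {r | ∀ t ∈ R, acceptOutput r σ t ≠ u} ≤
      (1 / 2) ^ R.card * (1 - p * (1 - p) * (4 - p) / 8) ^ J.card := by
  classical
  have := isProbabilityMeasure_bitsLaw h0 h1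
  choose! prev hprev hJ using hJ
  set N : Set (ℕ → Bits) := {r | ∀ j ∈ J, r ∉ acceptEvent σ u R prev j} with hN
  have hNm : MeasurableSet N := measurableSet_forall_notMem fun j hj =>
    measurableSet_acceptEvent (hJ j hj).1.le
  have hdep := dependsOn_choiceWeight (out := fun r => acceptOutput r σ)
    (fun r r' j h => acceptOutput_congr h fun _ _ => rfl) 0 u R
  have hD : MeasurableSet {r : ℕ → Bits | ∀ t ∈ R, acceptOutput r σ t ≠ u} := by
    have := hdep.measurable_Iic (measurableSet_singleton 1)
    convert this using 1
    ext r
    simp [choiceWeight_zero, Set.indicator_apply]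
  have h2 : (iidLaw (bitsLaw p)).real {r | ∀ t ∈ R, acceptOutput r σ t ≠ u} =
      ∫ r, choiceWeight 0 u R (acceptOutput r σ) ∂iidLaw (bitsLaw p) := by
    rw [← integral_indicator_one hD]
    refine integral_congr_ae (Filter.Eventually.of_forall fun r => ?_)
    simp only [choiceWeight_zero]
    rfl
  rw [h2, integral_iidLaw_bitsLaw_repick h0 h1 hdep.measurable_Iic (hdep.integrable_Iic _)]
  have h3 : ∀ r, ∫ x, choiceWeight 0 u R (acceptOutput (repick r x) σ) ∂iidLaw fairBit ≤
      (1 / 2) ^ R.card * N.indicator 1 r := by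
    intro r
    have hM := isPairMatching_accept r σ
    have hout := fun x => isMatchedOutput_acceptOutput_repick r x σ
    -- Outside `N` a match inside `R` makes the probability zero; on `N` the bound (1/2)^|R|
    -- applies.
    by_cases hr : r ∈ N
    · rw [Set.indicator_of_mem hr]
      simpa using integral_choiceWeight_le hM hout le_rfl hR
    · rw [Set.indicator_of_notMem hr, mul_zero]
      simp only [hN, Set.mem_ofPred_eq, not_forall, not_not] at hr
      obtain ⟨j, hj, hr⟩ := hr
      obtain ⟨i, hi, x, h⟩ := exists_accept_of_mem_acceptEvent (hJ j hj) (hprev j hj) hr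
      have := integral_choiceWeight_le_of_matched hM hout le_rfl hR ⟨i, hi, j, hJR hj, x, h⟩
      simpa using this
  refine (integral_mono_of_nonneg (Filter.Eventually.of_forall fun r =>
    integral_nonneg fun x => choiceWeight_nonneg le_rfl _ _ _) ?_
    (Filter.Eventually.of_forall h3)).trans ?_
  · exact ((integrable_const 1).indicator hNm).const_mul _
  · rw [integral_const_mul, integral_indicator_one hNm]
    exact mul_le_mul_of_nonneg_left
      (iidLaw_forall_notMem_acceptEvent_le hJR hJ hprev h0 h1) (by positivity)

/-- All subsequences are merged into one set `R`, which need not be consecutive. A match between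
different subsequences only helps, and each nonempty one supplies all its pairs but the first as
targets. -/
theorem isGamma_acceptOCS {p : ℝ} (h0 : 0 ≤ p) (h1 : p ≤ 1) :
    (acceptOCS V h0 h1).IsGamma (p * (1 - p) * (4 - p) / 8) := by
  classical
  intro σ u m S hS hd
  choose J hJS hJc hJ using fun i => (hS i).exists_targets
  have hd' : ((Finset.univ : Finset (Fin m)) : Set (Fin m)).PairwiseDisjoint S :=
    fun i _ j _ hij => hd i j hij
  have hdJ : ((Finset.univ : Finset (Fin m)) : Set (Fin m)).PairwiseDisjoint J :=
    fun i _ j _ hij => (hd i j hij).mono (hJS i) (hJS j)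
  have key := acceptOCS_real_le (σ := σ) (u := u) (R := Finset.univ.biUnion S)
    (J := Finset.univ.biUnion J) ?_ (Finset.biUnion_mono fun i _ => hJS i) ?_ h0 h1
  · rw [Finset.card_biUnion hd', Finset.card_biUnion hdJ] at key
    rw [Finset.prod_mul_distrib, Finset.prod_pow_eq_pow_sum, Finset.prod_pow_eq_pow_sum]
    simp_rw [hJc] at key
    have hset : {r : ℕ → Bits | ∀ t ∈ Finset.univ.biUnion S, acceptOutput r σ t ≠ u} =
        {r | ∀ i, ∀ t ∈ S i, acceptOutput r σ t ≠ u} := by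
      ext r
      simp only [Finset.mem_biUnion, Finset.mem_univ, true_and, forall_exists_index,
        Set.mem_ofPred_eq]
      exact forall_comm
    rw [hset] at key
    exact key
  · simp only [Finset.mem_biUnion, Finset.mem_univ, true_and, forall_exists_index]
    exact fun t i ht => (hS i).1 t ht
  · simp only [Finset.mem_biUnion, Finset.mem_univ, true_and, forall_exists_index]
    intro j i hj
    obtain ⟨k, hk, h⟩ := hJ i j hj
    exact ⟨k, ⟨i, hk⟩, h⟩

/-- The sender probability (5 - √13)/3 is the root in [0, 1] of 3p^2 - 10p + 4, the derivative of
p(1 - p)(4 - p), and so maximizes the parameter. -/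
theorem exists_isGamma_gammaB (V : Type*) : ∃ B : OCS 2 V, B.IsGamma gammaB := by
  have hs : √13 * √13 = 13 := Real.mul_self_sqrt (by norm_num)
  have h3 : 3 ≤ √13 := Real.le_sqrt_of_sq_le (by norm_num)
  have h4 : √13 ≤ 4 := Real.sqrt_le_iff.2 ⟨by norm_num, by norm_num⟩
  have h0 : 0 ≤ (5 - √13) / 3 := by linarith
  have h1 : (5 - √13) / 3 ≤ 1 := by linarith
  refine ⟨acceptOCS V h0 h1, ?_⟩
  convert isGamma_acceptOCS (V := V) h0 h1 using 1
  unfold gammaB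
  linear_combination (√13 / 216) * hs

end Gamma

/-! ### Expected weights for the first OCS. -/

section FirstOCS

variable {V : Type*} {σ : ℕ → KSet 2 V} {u : V} {R : Finset ℕ}

/-- The missing probability with `l` certain and `n` fair offers of `u`, scaled by `1 - g`. -/
noncomputable def missNone (g : ℝ) (l n : ℕ) : ℝ :=
  ((1 - g) / 2) ^ l * ((3 - g) / 4) ^ n - g * (0 ^ l * (1 / 2) ^ n)

/-- The missing probability with `l` certain and `n` fair offers of `u`, two of which are matched,
scaled by `1 - g`. -/
noncomputable def missMatched (g : ℝ) (l n : ℕ) : ℝ :=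
  ((1 - g) / 2) ^ l * ((1 - g) / 2 * ((3 - g) / 4) ^ (n - 2))

/-- A match only helps, which allows an upper bound on the probability of no match to be inserted.
-/
theorem missMatched_le_missNone {g : ℝ} (h0 : 0 ≤ g) (h1 : g ≤ 1) (l n : ℕ) :
    missMatched g l n ≤ missNone g l n := by
  unfold missMatched missNone
  have hβ : 0 ≤ (1 - g) / 2 := by linarith
  have key : (1 - g) / 2 * ((3 - g) / 4) ^ (n - 2) ≤
      ((3 - g) / 4) ^ n - g * (1 / 2) ^ n := by
    match n with
    | 0 => simp; linarith
    | 1 => simp; linarith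
    | n + 2 =>
      have h2 : (1 / 2 : ℝ) ^ n ≤ ((3 - g) / 4) ^ n :=
        pow_le_pow_left₀ (by norm_num) (by linarith) n
      rw [Nat.add_sub_cancel, pow_add, pow_add]
      have h3 : 0 ≤ (1 / 2 : ℝ) ^ n := by positivity
      -- Since ((3 - g)/4)^2 - (1 - g)/2 = (1 + g)^2/16, the difference is at least ((1 + g)^2 -
      -- 4g)/16 = (1 - g)^2/16 times (1/2)^n.
      nlinarith [mul_le_mul_of_nonneg_left h2 (sq_nonneg (1 + g)),
        mul_nonneg h3 (sq_nonneg (1 - g))]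
  rcases Nat.eq_zero_or_pos l with rfl | hl
  · simpa using key
  · rw [zero_pow hl.ne', zero_mul, mul_zero, sub_zero]
    refine mul_le_mul_of_nonneg_left (key.trans ?_) (pow_nonneg hβ l)
    have : 0 ≤ g * (1 / 2) ^ n := by positivity
    linarith

/-- The expected scaled missing probability, when `l` offers of `u` are certain and the other ones
are made by the ex-post-graph OCS on consecutive pairs. -/
theorem integral_exPostOCS_le (hR : IsConsecutive σ u R) {g : ℝ} (h0 : 0 ≤ g) (h1 : g ≤ 1)
    (l : ℕ) :
    ∫ r, (((1 - g) / 2) ^ l * choiceWeight ((1 - g) / 2) u R (exPostOutput r σ) -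
        g * (0 ^ l * choiceWeight 0 u R (exPostOutput r σ))) ∂iidUniform Bits ≤
      missMatched g l R.card + (15 / 16) ^ (R.card - 1) *
        (missNone g l R.card - missMatched g l R.card) := by
  classical
  have hβ : 0 ≤ (1 - g) / 2 := by linarith
  have hp0 : (0 : ℝ) ≤ 1 / 2 := by norm_num
  have hp1 : (1 / 2 : ℝ) ≤ 1 := by norm_num
  have := isProbabilityMeasure_bitsLaw hp0 hp1
  have hlaw : iidUniform Bits = iidLaw (bitsLaw (1 / 2)) := by
    unfold iidUniform
    rw [toMeasure_uniformOfFintype_bits]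
  rw [hlaw]
  obtain ⟨J, hJR, hJc, hJ⟩ := hR.exists_targets
  choose! prev hprev hJ using hJ
  set N : Set (ℕ → Bits) := {r | ∀ j ∈ J, r ∉ exPostEvent σ u prev j} with hN
  have hNm : MeasurableSet N := measurableSet_forall_notMem fun j hj =>
    measurableSet_exPostEvent (hJ j hj).1.le
  have hdep : ∀ β, DependsOn (fun r => choiceWeight β u R (exPostOutput r σ))
      (Set.Iic (R.sup id)) := fun β =>
    dependsOn_choiceWeight (out := fun r => exPostOutput r σ)
      (fun r r' j h => exPostOutput_congr h fun _ _ => rfl) β u R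
  have hdep' : DependsOn (fun r => ((1 - g) / 2) ^ l *
      choiceWeight ((1 - g) / 2) u R (exPostOutput r σ) -
        g * (0 ^ l * choiceWeight 0 u R (exPostOutput r σ))) (Set.Iic (R.sup id)) := by
    intro r r' h
    have e1 := hdep ((1 - g) / 2) h
    have e2 := hdep 0 h
    simp only at e1 e2 ⊢
    rw [e1, e2]
  rw [integral_iidLaw_bitsLaw_repick hp0 hp1 hdep'.measurable_Iic (hdep'.integrable_Iic _)]
  have hle := missMatched_le_missNone h0 h1 l R.card
  have hint : ∀ (β : ℝ) (r : ℕ → Bits),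
      Integrable (fun x => choiceWeight β u R (exPostOutput (repick r x) σ)) (iidLaw fairBit) := by
    intro β r
    refine (dependsOn_choiceWeight (out := fun x => exPostOutput (repick r x) σ)
      (fun x x' j h => exPostOutput_congr (fun i hi => ?_) fun _ _ => rfl) β u R).integrable_Iic _
    unfold repick
    rw [h i hi]
  -- With a match the subtracted term is dropped. Without one both weights are computed exactly, as
  -- the negative sign of the second forbids a mere upper bound.
  have hpt : ∀ r, ∫ x, (((1 - g) / 2) ^ l *
      choiceWeight ((1 - g) / 2) u R (exPostOutput (repick r x) σ) -
        g * (0 ^ l * choiceWeight 0 u R (exPostOutput (repick r x) σ))) ∂iidLaw fairBit ≤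
      missMatched g l R.card +
        N.indicator 1 r * (missNone g l R.card - missMatched g l R.card) := by
    intro r
    have hM := isPairMatching_exPost r σ
    have hout := fun x => isMatchedOutput_exPostOutput_repick r x σ
    rw [integral_sub ((hint _ r).const_mul _) (((hint _ r).const_mul _).const_mul _),
      integral_const_mul, integral_const_mul, integral_const_mul]
    by_cases hm : ∃ i ∈ R, ∃ j ∈ R, ∃ x, ExPost r σ i j x
    · have e1 := integral_choiceWeight_le_of_matched hM hout hβ hR.1 hm
      have e2 : 0 ≤ ∫ x, choiceWeight 0 u R (exPostOutput (repick r x) σ) ∂iidLaw fairBit :=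
        integral_nonneg fun x => choiceWeight_nonneg le_rfl _ _ _
      have e3 : (0 : ℝ) ≤ N.indicator 1 r := Set.indicator_nonneg (fun _ _ => zero_le_one) r
      have e4 : 0 ≤ g * (0 ^ l *
          ∫ x, choiceWeight 0 u R (exPostOutput (repick r x) σ) ∂iidLaw fairBit) := by
        positivity
      have e5 := mul_le_mul_of_nonneg_left e1 (pow_nonneg hβ l)
      have e6 : (1 + (1 - g) / 2) / 2 = (3 - g) / 4 := by ring
      rw [e6] at e5
      have e7 := mul_nonneg e3 (sub_nonneg.2 hle)
      have e8 : ((1 - g) / 2) ^ l * ((1 - g) / 2 * ((3 - g) / 4) ^ (R.card - 2)) =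
        missMatched g l R.card := rfl
      linarith
    · have hr : r ∈ N := fun j hj h =>
        hm ⟨_, hprev j hj, j, hJR hj, u, exPost_of_mem_exPostEvent (hJ j hj) h⟩
      rw [integral_choiceWeight_of_unmatched hM hout hR.1 hm,
        integral_choiceWeight_of_unmatched hM hout hR.1 hm, Set.indicator_of_mem hr]
      refine le_of_eq ?_
      simp only [missNone, Pi.one_apply]
      ring_nf
  have hdepK : DependsOn (fun r => ∫ x, (((1 - g) / 2) ^ l *
      choiceWeight ((1 - g) / 2) u R (exPostOutput (repick r x) σ) -
        g * (0 ^ l * choiceWeight 0 u R (exPostOutput (repick r x) σ))) ∂iidLaw fairBit)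
      (Set.Iic (R.sup id)) := by
    intro r r' h
    refine integral_congr_ae (Filter.Eventually.of_forall fun x => ?_)
    refine hdep' fun i hi => ?_
    unfold repick
    rw [h i hi]
  refine (integral_mono (hdepK.integrable_Iic _) ?_ hpt).trans ?_
  · exact (integrable_const _).add (((integrable_const 1).indicator hNm).mul_const _)
  · rw [integral_add (integrable_const _) (((integrable_const 1).indicator hNm).mul_const _),
      integral_mul_const, integral_const, probReal_univ, one_smul]
    have e1 : ∫ r, N.indicator (1 : (ℕ → Bits) → ℝ) r ∂iidLaw (bitsLaw (1 / 2)) =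
      (iidLaw (bitsLaw (1 / 2))).real N := integral_indicator_one hNm
    have e2 := iidLaw_forall_notMem_exPostEvent_le hJ hp0 hp1
    rw [e1, ← hJc]
    have e3 : (1 - 1 / 2 / 2 * ((1 - 1 / 2) / 2) : ℝ) = 15 / 16 := by norm_num
    rw [e3] at e2
    have := mul_le_mul_of_nonneg_right e2 (sub_nonneg.2 hle)
    linarith

end FirstOCS

/-! ### Numerical values and the closed bound. -/

section Numerics

theorem gammaB_gt : 0.10992746834 < gammaB := by
  have : 3.6055512754639 < √13 := Real.lt_sqrt_of_sq_lt (by norm_num)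
  unfold gammaB
  linarith

theorem gammaB_lt : gammaB < 0.10992746835 := by
  have : √13 < 3.605551275464 := (Real.sqrt_lt' (by norm_num)).2 (by norm_num)
  unfold gammaB
  linarith

theorem t₁_bounds : 0.63002417721 < t₁ ∧ t₁ < 0.63002417723 := by
  have h1 := gammaB_gt
  have h2 := gammaB_lt
  unfold t₁
  constructor <;> linarith

theorem t₂_bounds : 0.59991925501 < t₂ ∧ t₂ < 0.59991925502 := by
  have h1 := gammaB_gt
  have h2 := gammaB_lt
  unfold t₂ gammaA
  constructor <;> linarith

theorem t₃_bounds : 0.14834542194 < t₃ ∧ t₃ < 0.148345421945 := by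
  have h1 := gammaB_gt
  have h2 := gammaB_lt
  unfold t₃
  constructor <;> linarith

theorem t₄_eq : t₄ = 0.3125 := by
  norm_num [t₄, gammaA]

theorem sq_three_sub_gammaB_bounds :
    2.89007253165 ^ 2 < (3 - gammaB) ^ 2 ∧ (3 - gammaB) ^ 2 < 2.89007253166 ^ 2 := by
  have h1 := gammaB_gt
  have h2 := gammaB_lt
  constructor <;> gcongr <;> linarith

theorem c₁_bounds : 0.9577948 < c₁ ∧ c₁ < 0.9577949 := by
  obtain ⟨h1, h2⟩ := sq_three_sub_gammaB_bounds
  have h0 : 0 < (3 - gammaB) ^ 2 := by positivity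
  unfold c₁
  rw [lt_div_iff₀ h0, div_lt_iff₀ h0]
  constructor <;> nlinarith

theorem c₂_bounds : 0.1767563 < c₂ ∧ c₂ < 0.1767564 := by
  have h1 := gammaB_gt
  have h2 := gammaB_lt
  have h0 : 0 < (1 - gammaA) * (1 - gammaB) * (3 - gammaB) ^ 2 := by
    have : 0 < 1 - gammaB := by linarith
    have : 0 < 3 - gammaB := by linarith
    have : 0 < 1 - gammaA := by norm_num [gammaA]
    positivity
  unfold c₂
  rw [lt_div_iff₀ h0, div_lt_iff₀ h0]
  unfold gammaA
  constructor <;> nlinarith [mul_pos (sub_pos.2 h1) (sub_pos.2 h2)]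

theorem c₃_eq : c₃ = c₂ / 16 := by
  unfold c₃ c₂ gammaA
  ring

theorem c₄_bounds : 0.1317375 < c₄ ∧ c₄ < 0.1317376 := by
  have h1 := gammaB_gt
  have h2 := gammaB_lt
  have h0 : 0 < (1 - gammaA) * (1 - gammaB) := by
    have : 0 < 1 - gammaB := by linarith
    have : 0 < 1 - gammaA := by norm_num [gammaA]
    positivity
  unfold c₄
  rw [lt_div_iff₀ h0, div_lt_iff₀ h0]
  unfold gammaA
  constructor <;> linarith

theorem eta_eq {k : ℕ} (hk : k ≠ 0) :
    eta k = c₁ * t₁ ^ k + c₂ * t₂ ^ k - c₃ * t₃ ^ k - c₄ * t₄ ^ k :=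
  if_neg hk

theorem eta_one : eta 1 = 2 / 3 := by
  have h2 := gammaB_lt
  have h3 : 1 - gammaB ≠ 0 := by linarith
  have h4 : 3 - gammaB ≠ 0 := by linarith
  rw [eta_eq one_ne_zero]
  unfold c₁ c₂ c₃ c₄ t₁ t₂ t₃ t₄ gammaA
  field_simp
  ring

theorem eta_two : eta 2 = 1 / 3 + 7 * (1 - gammaB) / 64 := by
  have h2 := gammaB_lt
  have h3 : 1 - gammaB ≠ 0 := by linarith
  have h4 : 3 - gammaB ≠ 0 := by linarith
  rw [eta_eq two_ne_zero]
  unfold c₁ c₂ c₃ c₄ t₁ t₂ t₃ t₄ gammaA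
  field_simp
  ring

/-- The constants `δ₁` and `δ₂` are essentially fixed by equality at k = 2 and k = 3. The slack is
below 10^-7 in both cases, hence the many digits of `gammaB`. -/
theorem eta_three_le : eta 3 ≤ (2 / 3 : ℝ) ^ 3 * (1 - δ₁) ^ 2 * (1 - δ₂) := by
  have h1 := gammaB_gt
  have h2 := gammaB_lt
  have h3 : 1 - gammaB ≠ 0 := by linarith
  have h4 : 3 - gammaB ≠ 0 := by linarith
  have : eta 3 = 16243 / 55296 - 323 / 1728 * gammaB + 1969 / 55296 * gammaB ^ 2 := by
    rw [eta_eq three_ne_zero]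
    unfold c₁ c₂ c₃ c₄ t₁ t₂ t₃ t₄ gammaA
    field_simp
    ring
  rw [this]
  unfold δ₁ δ₂
  nlinarith [mul_pos (sub_pos.2 h1) (sub_pos.2 h2)]

/-- From the third step on, the bound decreases at the rate of the closed bound. -/
theorem eta_succ_le {k : ℕ} (hk : 3 ≤ k) :
    eta (k + 1) ≤ 2 / 3 * (1 - δ₁) * (1 - δ₂) * eta k := by
  obtain ⟨h1, h1'⟩ := t₁_bounds
  obtain ⟨h2, h2'⟩ := t₂_bounds
  obtain ⟨h3, h3'⟩ := t₃_bounds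
  obtain ⟨d1, d1'⟩ := c₁_bounds
  obtain ⟨d2, d2'⟩ := c₂_bounds
  obtain ⟨d4, d4'⟩ := c₄_bounds
  obtain ⟨ρ, hρ⟩ : ∃ ρ : ℝ, ρ = 2 / 3 * (1 - δ₁) * (1 - δ₂) := ⟨_, rfl⟩
  have hρ1 : 0.635334 < ρ := by rw [hρ]; unfold δ₁ δ₂; norm_num
  have hρ2 : ρ < 0.635335 := by rw [hρ]; unfold δ₁ δ₂; norm_num
  rw [← hρ, eta_eq (by omega), eta_eq (by omega), c₃_eq, t₄_eq]
  obtain ⟨n, rfl⟩ := Nat.exists_eq_add_of_le hk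
  have p3 : t₃ ^ n ≤ 0.3125 ^ n := pow_le_pow_left₀ (by linarith) (by linarith) n
  have p4 : (0.3125 : ℝ) ^ n ≤ t₁ ^ n := pow_le_pow_left₀ (by norm_num) (by linarith) n
  have p0 : (0 : ℝ) ≤ 0.3125 ^ n := by positivity
  have p2 : 0 ≤ t₂ ^ n := pow_nonneg (by linarith) n
  have p3' : 0 ≤ t₃ ^ n := pow_nonneg (by linarith) n
  have q1 : 0.25 ≤ t₁ ^ 3 := by
    have : (0.63 : ℝ) ^ 3 ≤ t₁ ^ 3 := pow_le_pow_left₀ (by norm_num) (by linarith) 3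
    norm_num at this ⊢
    linarith
  have q3 : t₃ ^ 3 ≤ 0.15 ^ 3 := pow_le_pow_left₀ (by linarith) (by linarith) 3
  have e1 : 0.00126 * t₁ ^ n ≤ c₁ * t₁ ^ 3 * (ρ - t₁) * t₁ ^ n := by
    refine mul_le_mul_of_nonneg_right ?_ (p0.trans p4)
    have : 0.957 * 0.25 ≤ c₁ * t₁ ^ 3 := mul_le_mul (by linarith) q1 (by norm_num) (by linarith)
    have h : 0.0053 ≤ ρ - t₁ := by linarith
    nlinarith
  have e2 : 0.00130 * t₂ ^ n ≤ c₂ * t₂ ^ 3 * (ρ - t₂) * t₂ ^ n := by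
    refine mul_le_mul_of_nonneg_right ?_ p2
    have : 0.1767563 * 0.5999 ^ 3 ≤ c₂ * t₂ ^ 3 :=
      mul_le_mul (by linarith) (pow_le_pow_left₀ (by norm_num) (by linarith) 3) (by norm_num)
        (by linarith)
    have h : 0.0354 ≤ ρ - t₂ := by linarith
    nlinarith
  have p24 : (0.3125 : ℝ) ^ n ≤ t₂ ^ n := pow_le_pow_left₀ (by norm_num) (by linarith) n
  have e3 : c₂ / 16 * t₃ ^ 3 * (ρ - t₃) * t₃ ^ n ≤ 0.00003 * 0.3125 ^ n := by
    refine mul_le_mul ?_ p3 p3' (by norm_num)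
    have : c₂ / 16 * t₃ ^ 3 ≤ 0.012 * 0.15 ^ 3 :=
      mul_le_mul (by linarith) q3 (by positivity) (by norm_num)
    have h : ρ - t₃ ≤ 0.5 := by linarith
    have h' : 0 ≤ ρ - t₃ := by linarith
    calc _ ≤ (0.012 * 0.15 ^ 3 : ℝ) * 0.5 := mul_le_mul this h h' (by norm_num)
      _ ≤ _ := by norm_num
  have e4 : c₄ * 0.3125 ^ 3 * (ρ - 0.3125) * 0.3125 ^ n ≤ 0.0014 * 0.3125 ^ n := by
    refine mul_le_mul_of_nonneg_right ?_ p0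
    have h : ρ - 0.3125 ≤ 0.3229 := by linarith
    nlinarith
  -- The rate ρ ≈ 0.63533 exceeds every base. The negative terms of `eta` therefore work against the
  -- claim, but together they are at most 0.00143 · 0.3125^n, while the positive terms gain at least
  -- 0.00256 · 0.3125^n.
  have key : c₂ / 16 * t₃ ^ 3 * (ρ - t₃) * t₃ ^ n + c₄ * 0.3125 ^ 3 * (ρ - 0.3125) * 0.3125 ^ n ≤
      c₁ * t₁ ^ 3 * (ρ - t₁) * t₁ ^ n + c₂ * t₂ ^ 3 * (ρ - t₂) * t₂ ^ n := by
    linarith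
  have ep : ∀ t : ℝ, t ^ (3 + n) = t ^ 3 * t ^ n := fun t => pow_add t 3 n
  have ep' : ∀ t : ℝ, t ^ (3 + n + 1) = t ^ 3 * t * t ^ n := fun t => by ring
  simp only [ep, ep']
  linarith

theorem eta_le (k : ℕ) :
    eta k ≤ (2 / 3 : ℝ) ^ k * (1 - δ₁) ^ (k - 1) * (1 - δ₂) ^ (k - 2) := by
  have h1 := gammaB_gt
  match k with
  | 0 => simp [eta]
  | 1 => simp [eta_one]
  | 2 =>
    rw [eta_two]
    norm_num [δ₁]
    linarith
  | n + 3 =>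
    induction n with
    | zero => simpa using eta_three_le
    | succ n ih =>
      refine (eta_succ_le (by omega)).trans ?_
      have e : (0 : ℝ) ≤ 2 / 3 * (1 - δ₁) * (1 - δ₂) := by norm_num [δ₁, δ₂]
      refine (mul_le_mul_of_nonneg_left ih e).trans (le_of_eq ?_)
      rw [show n + 1 + 3 - 1 = n + 3 - 1 + 1 by omega, show n + 1 + 3 - 2 = n + 3 - 2 + 1 by omega]
      ring

end Numerics

/-! ### Averaging over the left-out elements and composing the two algorithms. -/

section ThreeWay

variable {V : Type*} [DecidableEq V] {σ : ℕ → KSet 3 V} {u : V} {S : Finset ℕ}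

/-- The bound on the expected scaled missing probability, given the number `l` of triples in which
`u` is left out and the number `n` of those in which it is not. -/
noncomputable def missBound (l n : ℕ) : ℝ :=
  c₁ * (((1 - gammaB) / 2) ^ l * ((3 - gammaB) / 4) ^ n) +
    c₂ * (((1 - gammaB) / 2) ^ l * (15 / 16 * ((3 - gammaB) / 4)) ^ n) -
    c₃ * (((1 - gammaB) / 2) ^ l * 0 ^ n) - c₄ * (0 ^ l * (15 / 32) ^ n)

/-- For n ≥ 1, `c₁` comes from β / ((3 - g)/4)^2 = 8(1 - g)/(3 - g)^2, and `c₂` from its complement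
(1 + g)^2/(3 - g)^2 times 16/15, because (15/16)^(n - 1) = 16/15 · (15/16)^n. The same 16/15 enters
`c₄`. At n = 0 the truncated exponent makes this factor wrong, and the `c₃` term corrects it for l >
0; l = n = 0 is a true exception, so `eta 0` is set separately. -/
theorem missMatched_add_eq_missBound {l n : ℕ} (h : l + n ≠ 0) :
    missMatched gammaB l n + (15 / 16) ^ (n - 1) * (missNone gammaB l n - missMatched gammaB l n) =
      (1 - gammaB) * missBound l n := by
  have h2 := gammaB_lt
  have h3 : 1 - gammaB ≠ 0 := by linarith
  have h4 : 3 - gammaB ≠ 0 := by linarith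
  unfold missMatched missNone missBound c₁ c₂ c₃ c₄ gammaA
  generalize ((1 - gammaB) / 2) ^ l = b
  match n with
  -- For n ≤ 1 the power of 15/16 is 1 and `missMatched` cancels, so its truncated exponent is
  -- harmless.
  | 0 =>
    have hl : l ≠ 0 := by omega
    simp only [zero_pow hl, pow_zero]
    field_simp
    ring
  | 1 =>
    generalize (0 : ℝ) ^ l = z
    simp only [pow_one, pow_zero, show 1 - 2 = 0 from rfl]
    field_simp
    ring
  | n + 2 =>
    generalize (0 : ℝ) ^ l = z
    have e : (15 / 32 : ℝ) = 15 / 16 * (1 / 2) := by norm_num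
    rw [e, Nat.add_sub_cancel, show n + 2 - 1 = n + 1 by omega, zero_pow (by omega), mul_pow,
      mul_pow]
    simp only [pow_succ]
    generalize ((3 - gammaB) / 4) ^ n = q
    generalize (15 / 16 : ℝ) ^ n = w
    generalize (1 / 2 : ℝ) ^ n = v
    field_simp
    ring

theorem integral_uniform_three (f : Fin 3 → ℝ) :
    ∫ x, f x ∂(PMF.uniformOfFintype (Fin 3)).toMeasure = (f 0 + f 1 + f 2) / 3 := by
  rw [PMF.integral_eq_sum, Fin.sum_univ_three]
  simp
  ring

/-- The triples of `S` in which `u` is left out. -/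
noncomputable def leftOut (σ : ℕ → KSet 3 V) (u : V) (S : Finset ℕ) (c : ℕ → Fin 3) : Finset ℕ :=
  S.filter fun t => (σ t).elt (c t) = u

/-- The triples of `S` in which `u` is not left out. -/
noncomputable def kept (σ : ℕ → KSet 3 V) (u : V) (S : Finset ℕ) (c : ℕ → Fin 3) : Finset ℕ :=
  S.filter fun t => ¬ (σ t).elt (c t) = u

theorem card_leftOut_add_card_kept (c : ℕ → Fin 3) :
    (leftOut σ u S c).card + (kept σ u S c).card = S.card :=
  Finset.card_filter_add_card_filter_not _

/-- A triple in which `u` is left out gives the first OCS a pair without `u`, so its removal creates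
no gap. -/
theorem isConsecutive_kept (hS : IsConsecutive σ u S) (c : ℕ → Fin 3) :
    IsConsecutive (firstInput σ c) u (kept σ u S c) := by
  have hmem : ∀ t, u ∈ (firstInput σ c t).1 ↔ ¬ (σ t).elt (c t) = u ∧ u ∈ (σ t).1 := fun t => by
    simp only [firstInput, Finset.mem_erase, ne_eq, eq_comm]
  refine ⟨fun t ht => ?_, fun a ha b hb t h1 h2 h3 => ?_⟩
  · obtain ⟨h1, h2⟩ := Finset.mem_filter.1 ht
    exact (hmem t).2 ⟨h2, hS.1 t h1⟩
  · obtain ⟨h4, h5⟩ := (hmem t).1 h3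
    exact Finset.mem_filter.2 ⟨hS.2 a (Finset.mem_filter.1 ha).1 b (Finset.mem_filter.1 hb).1 t
      h1 h2 h5, h4⟩

theorem pow_leftOut_mul_pow_kept (c : ℕ → Fin 3) (a b : ℝ) :
    a ^ (leftOut σ u S c).card * b ^ (kept σ u S c).card =
      ∏ t ∈ S, if (σ t).elt (c t) = u then a else b := by
  rw [Finset.prod_ite, Finset.prod_const, Finset.prod_const]
  rfl

theorem dependsOn_pow_leftOut_mul_pow_kept (a b : ℝ) :
    DependsOn (fun c => a ^ (leftOut σ u S c).card * b ^ (kept σ u S c).card)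
      (Set.Iic (S.sup id)) := by
  intro c c' h
  simp only [pow_leftOut_mul_pow_kept]
  refine Finset.prod_congr rfl fun t ht => ?_
  rw [h t (Finset.le_sup (f := id) ht)]

/-- Independently in each triple, exactly one of the three equally likely indices leaves `u` out. -/
theorem integral_pow_leftOut_mul_pow_kept (hS : ∀ t ∈ S, u ∈ (σ t).1) (a b : ℝ) :
    ∫ c, a ^ (leftOut σ u S c).card * b ^ (kept σ u S c).card ∂iidUniform (Fin 3) =
      ((a + 2 * b) / 3) ^ S.card := by
  simp_rw [pow_leftOut_mul_pow_kept]
  refine (integral_iidLaw_prod (PMF.uniformOfFintype (Fin 3)).toMeasure S id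
    (fun _ _ _ _ h => h) (fun t x => if (σ t).elt x = u then a else b)).trans ?_
  rw [Finset.prod_congr rfl (g := fun _ => (a + 2 * b) / 3), Finset.prod_const]
  intro t ht
  rw [integral_uniform_three]
  obtain ⟨i, rfl⟩ := (σ t).exists_elt_eq (hS t ht)
  simp only [(σ t).elt_injective.eq_iff]
  fin_cases i <;> simp <;> ring

theorem integrable_missBound :
    Integrable (fun c => missBound (leftOut σ u S c).card (kept σ u S c).card)
      (iidUniform (Fin 3)) := by
  have h : ∀ a b : ℝ, Integrable
      (fun c => a ^ (leftOut σ u S c).card * b ^ (kept σ u S c).card) (iidUniform (Fin 3)) :=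
    fun a b => (dependsOn_pow_leftOut_mul_pow_kept a b).integrable_Iic _
  exact ((((h _ _).const_mul _).add ((h _ _).const_mul _)).sub ((h _ _).const_mul _)).sub
    ((h _ _).const_mul _)

theorem integral_missBound (hS : ∀ t ∈ S, u ∈ (σ t).1) (hne : S.card ≠ 0) :
    ∫ c, missBound (leftOut σ u S c).card (kept σ u S c).card ∂iidUniform (Fin 3) =
      eta S.card := by
  have h : ∀ a b : ℝ, Integrable
      (fun c => a ^ (leftOut σ u S c).card * b ^ (kept σ u S c).card) (iidUniform (Fin 3)) :=
    fun a b => (dependsOn_pow_leftOut_mul_pow_kept a b).integrable_Iic _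
  have hlin : ∀ f₁ f₂ f₃ f₄ : (ℕ → Fin 3) → ℝ, Integrable f₁ (iidUniform (Fin 3)) →
      Integrable f₂ (iidUniform (Fin 3)) → Integrable f₃ (iidUniform (Fin 3)) →
      Integrable f₄ (iidUniform (Fin 3)) →
      ∫ c, (c₁ * f₁ c + c₂ * f₂ c - c₃ * f₃ c - c₄ * f₄ c) ∂iidUniform (Fin 3) =
        c₁ * ∫ c, f₁ c ∂iidUniform (Fin 3) + c₂ * ∫ c, f₂ c ∂iidUniform (Fin 3) -
          c₃ * ∫ c, f₃ c ∂iidUniform (Fin 3) - c₄ * ∫ c, f₄ c ∂iidUniform (Fin 3) := by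
    intro f₁ f₂ f₃ f₄ h₁ h₂ h₃ h₄
    rw [integral_sub (f := fun c => c₁ * f₁ c + c₂ * f₂ c - c₃ * f₃ c)
        (((h₁.const_mul _).add (h₂.const_mul _)).sub (h₃.const_mul _)) (h₄.const_mul _),
      integral_sub (f := fun c => c₁ * f₁ c + c₂ * f₂ c)
        ((h₁.const_mul _).add (h₂.const_mul _)) (h₃.const_mul _),
      integral_add (h₁.const_mul _) (h₂.const_mul _)]
    simp only [integral_const_mul]
  unfold missBound
  rw [hlin _ _ _ _ (h _ _) (h _ _) (h _ _) (h _ _)]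
  simp only [integral_pow_leftOut_mul_pow_kept hS]
  rw [eta_eq hne]
  unfold t₁ t₂ t₃ t₄ gammaA
  ring_nf

/-- The weight `β ^ n`, where `n` is the number of the pairs in `S` given to the second OCS that
contain `u`. -/
noncomputable def offerWeight (A : OCS 2 V) (σ : ℕ → KSet 3 V) (u : V) (S : Finset ℕ) (β : ℝ)
    (z : (ℕ → Fin 3) × A.Seed) : ℝ :=
  ∏ t ∈ S, if u ∈ (secondInput A σ z.1 z.2 t).1 then β else 1

theorem offerWeight_eq_pow (A : OCS 2 V) (β : ℝ) (z : (ℕ → Fin 3) × A.Seed) :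
    offerWeight A σ u S β z =
      β ^ (S.filter fun t => u ∈ (secondInput A σ z.1 z.2 t).1).card := by
  unfold offerWeight
  rw [Finset.prod_ite, Finset.prod_const, Finset.prod_const_one, mul_one]

/-- A left-out `u` surely reaches the second OCS; a kept one does exactly when the first OCS chooses
it. -/
theorem offerWeight_eq_mul (A : OCS 2 V) (β : ℝ) (c : ℕ → Fin 3) (a : A.Seed) :
    offerWeight A σ u S β (c, a) = β ^ (leftOut σ u S c).card *
      choiceWeight β u (kept σ u S c) (A.output a (firstInput σ c)) := by
  unfold offerWeight choiceWeight
  rw [← Finset.prod_filter_mul_prod_filter_not S fun t => (σ t).elt (c t) = u]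
  congr 1
  · rw [Finset.prod_congr rfl (g := fun _ => β), Finset.prod_const]
    · rfl
    · intro t ht
      refine if_pos ?_
      simp [secondInput, (Finset.mem_filter.1 ht).2]
  · refine Finset.prod_congr rfl fun t ht => ?_
    have h1 := (Finset.mem_filter.1 ht).2
    have h2 : u ∈ (secondInput A σ c a t).1 ↔ A.output a (firstInput σ c) t = u := by
      simp only [secondInput, Finset.mem_insert, Finset.mem_singleton]
      exact ⟨fun h => (h.resolve_right fun h => h1 h.symm).symm, fun h => Or.inl h.symm⟩
    by_cases h3 : A.output a (firstInput σ c) t = u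
    · rw [if_pos (h2.2 h3), if_pos h3]
    · rw [if_neg (mt h2.1 h3), if_neg h3]

theorem measurable_offerWeight (A : OCS 2 V) (β : ℝ) : Measurable (offerWeight A σ u S β) := by
  unfold offerWeight
  refine Finset.measurable_prod _ fun t _ => Measurable.ite ?_ measurable_const measurable_const
  have h1 : MeasurableSet {z : (ℕ → Fin 3) × A.Seed |
      A.output z.2 (firstInput σ z.1) t = u} :=
    A.measurable_comp (firstInput σ) (fun i => (σ i).1)
      (fun _ _ => Finset.erase_subset _ _) (measurable_firstInput σ) t u
  have hm : Measurable fun z : (ℕ → Fin 3) × A.Seed => z.1 t := by fun_prop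
  have h2 : MeasurableSet {z : (ℕ → Fin 3) × A.Seed | (σ t).elt (z.1 t) = u} :=
    hm (Set.toFinite {k : Fin 3 | (σ t).elt k = u}).measurableSet
  convert h1.union h2 using 1
  ext z
  simp only [secondInput, Finset.mem_insert, Finset.mem_singleton, Set.mem_ofPred_eq,
    Set.mem_union, eq_comm]

theorem abs_offerWeight_le (A : OCS 2 V) {β : ℝ} (h0 : 0 ≤ β) (h1 : β ≤ 1)
    (z : (ℕ → Fin 3) × A.Seed) : ‖offerWeight A σ u S β z‖ ≤ 1 := by
  rw [offerWeight_eq_pow, Real.norm_of_nonneg (pow_nonneg h0 _)]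
  exact pow_le_one₀ h0 h1

theorem integrable_offerWeight (A : OCS 2 V) {β : ℝ} (h0 : 0 ≤ β) (h1 : β ≤ 1) :
    Integrable (offerWeight A σ u S β) ((iidUniform (Fin 3)).prod A.law) :=
  Integrable.of_bound (measurable_offerWeight A β).aestronglyMeasurable 1
    (Filter.Eventually.of_forall (abs_offerWeight_le A h0 h1))

theorem isConsecutive_secondInput (A : OCS 2 V) (hS : IsConsecutive σ u S)
    (z : (ℕ → Fin 3) × A.Seed) :
    IsConsecutive (secondInput A σ z.1 z.2) u
      (S.filter fun t => u ∈ (secondInput A σ z.1 z.2 t).1) := by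
  refine ⟨fun t ht => (Finset.mem_filter.1 ht).2, fun a ha b hb t h1 h2 h3 => ?_⟩
  exact Finset.mem_filter.2 ⟨hS.2 a (Finset.mem_filter.1 ha).1 b (Finset.mem_filter.1 hb).1 t
    h1 h2 (secondInput_subset A σ z.1 z.2 t h3), h3⟩

theorem OCS.measurableSet_forall_ne {n : ℕ} {W : Type*} (B : OCS n W) (τ : ℕ → KSet n W) (v : W)
    (R : Finset ℕ) : MeasurableSet {r | ∀ t ∈ R, B.output r τ t ≠ v} := by
  have : {r | ∀ t ∈ R, B.output r τ t ≠ v} = ⋂ t ∈ R, {r | B.output r τ t = v}ᶜ := by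
    ext r
    simp
  rw [this]
  exact Finset.measurableSet_biInter _ fun t _ => (B.measurable_output τ t v).compl

/-- The guarantee of a two-way OCS for a single consecutive subsequence. -/
theorem OCS.IsGamma.real_le {W : Type*} {B : OCS 2 W} {γ : ℝ} (hB : B.IsGamma γ)
    {τ : ℕ → KSet 2 W} {v : W} {R : Finset ℕ} (hR : IsConsecutive τ v R) :
    B.law.real {r | ∀ t ∈ R, B.output r τ t ≠ v} ≤
      (1 / 2) ^ R.card * (1 - γ) ^ (R.card - 1) := by
  have := hB τ v 1 (fun _ => R) (fun _ => hR) fun i j hij => absurd (Subsingleton.elim i j) hij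
  simpa using this

/-- The conditional missing probability, given the input of the second OCS. -/
theorem second_real_le (A : OCS 2 V) {B : OCS 2 V} (hB : B.IsGamma gammaB)
    (hS : IsConsecutive σ u S) (z : (ℕ → Fin 3) × A.Seed) :
    B.law.real {b | ∀ t ∈ S, B.output b (secondInput A σ z.1 z.2) t ≠ u} ≤
      (offerWeight A σ u S ((1 - gammaB) / 2) z - gammaB * offerWeight A σ u S 0 z) /
        (1 - gammaB) := by
  have h2 := gammaB_lt
  have h3 : 0 < 1 - gammaB := by linarith
  have h := hB.real_le (isConsecutive_secondInput A hS z)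
  have hsub : {b | ∀ t ∈ S, B.output b (secondInput A σ z.1 z.2) t ≠ u} ⊆
      {b | ∀ t ∈ S.filter fun t => u ∈ (secondInput A σ z.1 z.2 t).1,
        B.output b (secondInput A σ z.1 z.2) t ≠ u} :=
    fun b hb t ht => hb t (Finset.mem_filter.1 ht).1
  refine (measureReal_mono hsub).trans (h.trans ?_)
  rw [offerWeight_eq_pow, offerWeight_eq_pow, le_div_iff₀ h3]
  generalize (S.filter fun t => u ∈ (secondInput A σ z.1 z.2 t).1).card = m
  cases m with
  -- The weight 0^m repairs precisely the case m = 0, where the exponent m - 1 is truncated.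
  | zero => simp
  | succ m =>
    rw [Nat.add_sub_cancel, div_pow, zero_pow (by omega), div_pow, one_pow]
    refine le_of_eq ?_
    field_simp
    ring

/-- Integrate out the second OCS, then the first one, then the left-out elements, using independence
at each stage. -/
theorem threeWayOCS_real_le_eta {B : OCS 2 V} (hB : B.IsGamma gammaB)
    (hS : IsConsecutive σ u S) :
    (threeWayOCS B).law.real {r | ∀ t ∈ S, (threeWayOCS B).output r σ t ≠ u} ≤ eta S.card := by
  have h1 := gammaB_gt
  have h2 := gammaB_lt
  by_cases hne : S.card = 0
  · rw [hne, eta, if_pos rfl]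
    exact measureReal_le_one
  have hβ0 : 0 ≤ (1 - gammaB) / 2 := by linarith
  have hβ1 : (1 - gammaB) / 2 ≤ 1 := by linarith
  have hg : 1 - gammaB ≠ 0 := by linarith
  set A := exPostOCS V with hA
  set ν := (iidUniform (Fin 3)).prod A.law with hν
  set D : Set (((ℕ → Fin 3) × A.Seed) × B.Seed) :=
    {r | ∀ t ∈ S, B.output r.2 (secondInput A σ r.1.1 r.1.2) t ≠ u} with hD
  have hDm : MeasurableSet D := (threeWayOCS B).measurableSet_forall_ne σ u S
  change (ν.prod B.law).real D ≤ eta S.card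
  have e1 : (ν.prod B.law).real D = ∫ z, B.law.real (Prod.mk z ⁻¹' D) ∂ν := by
    rw [← integral_indicator_one hDm, integral_prod _ ((integrable_const 1).indicator hDm)]
    refine integral_congr_ae (Filter.Eventually.of_forall fun z => ?_)
    exact integral_indicator_one (measurable_prodMk_left hDm)
  have hw : Integrable (fun z => (offerWeight A σ u S ((1 - gammaB) / 2) z -
      gammaB * offerWeight A σ u S 0 z) / (1 - gammaB)) ν :=
    ((integrable_offerWeight A hβ0 hβ1).sub
      ((integrable_offerWeight A le_rfl zero_le_one).const_mul _)).div_const _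
  rw [e1, ← integral_missBound hS.1 hne]
  refine (integral_mono_of_nonneg (Filter.Eventually.of_forall fun z => measureReal_nonneg) hw
    (Filter.Eventually.of_forall fun z => second_real_le A hB hS z)).trans ?_
  rw [integral_prod _ hw]
  refine integral_mono hw.integral_prod_left integrable_missBound fun c => ?_
  have h3 := integral_exPostOCS_le (isConsecutive_kept hS c) (g := gammaB) (by linarith)
    (by linarith) (leftOut σ u S c).card
  rw [missMatched_add_eq_missBound (by rw [card_leftOut_add_card_kept]; exact hne)] at h3
  simp only [integral_div, offerWeight_eq_mul]
  rw [div_le_iff₀ (by linarith), mul_comm (missBound _ _)]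
  exact h3

end ThreeWay

theorem theorem2 {V : Type*} [DecidableEq V] :
    -- a two-way OCS with the parameter required of the second OCS exists
    (∃ B : OCS 2 V, B.IsGamma gammaB) ∧
    -- with any such second OCS, the three-way OCS misses `u` with probability at most `eta k`
    (∀ B : OCS 2 V, B.IsGamma gammaB →
      ∀ (σ : ℕ → KSet 3 V) (u : V) (S : Finset ℕ), IsConsecutive σ u S →
        (threeWayOCS B).law.real {r | ∀ t ∈ S, (threeWayOCS B).output r σ t ≠ u} ≤
          eta S.card) ∧
    -- the weaker closed bound
    (∀ k : ℕ, eta k ≤ (2 / 3 : ℝ) ^ k * (1 - δ₁) ^ (k - 1) * (1 - δ₂) ^ (k - 2)) ∧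
    -- the numerical values of the constants, to six decimals
    (|c₁ - 0.957795| < 1 / 10 ^ 6 ∧ |c₂ - 0.176756| < 1 / 10 ^ 6 ∧
      |c₃ - 0.011047| < 1 / 10 ^ 6 ∧ |c₄ - 0.131738| < 1 / 10 ^ 6 ∧
      |t₁ - 0.630024| < 1 / 10 ^ 6 ∧ |t₂ - 0.599919| < 1 / 10 ^ 6 ∧
      |t₃ - 0.148345| < 1 / 10 ^ 6 ∧ t₄ = 0.3125) := by
  refine ⟨exists_isGamma_gammaB V, fun B hB σ u S hS => threeWayOCS_real_le_eta hB hS, eta_le, ?_⟩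
  obtain ⟨h1, h1'⟩ := c₁_bounds
  obtain ⟨h2, h2'⟩ := c₂_bounds
  obtain ⟨h4, h4'⟩ := c₄_bounds
  obtain ⟨h5, h5'⟩ := t₁_bounds
  obtain ⟨h6, h6'⟩ := t₂_bounds
  obtain ⟨h7, h7'⟩ := t₃_bounds
  rw [c₃_eq]
  refine ⟨?_, ?_, ?_, ?_, ?_, ?_, ?_, t₄_eq⟩ <;> rw [abs_lt] <;> constructor <;> linarith
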